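/- For $\tau$ in the upper half plane $\mathbb{H}=\{\tau\in\mathbb{C}:\operatorname{Im}\tau>0\}$ put $q=e^{2\pi i\tau}$ and $$f(\tau)=\frac{11+5\sqrt5}{2}\prod_{n=1}^{\infty}\frac{\left(1+\frac{1+\sqrt5}{2}q^n+q^{2n}\right)^5}{\left(1+\frac{1-\sqrt5}{2}q^n+q^{2n}\right)^5}.$$ Let $d_{j,k}(n)$ be the number of positive divisors $d$ of $n$ with $d\equiv j \pmod k$, and let $S=-3P+Q$, where $$P(\tau)=\cot\tfrac{2\pi}{5}+4\sin\tfrac{4\pi}{5}\sum_{n\ge1}(d_{1,5}(n)-d_{4,5}(n))q^n-4\sin\tfrac{2\pi}{5}\sum_{n\ge1}(d_{2,5}(n)-d_{3,5}(n))q^n,$$ $$Q(\tau)=\cot\tfrac{\pi}{5}+4\sin\tfrac{2\pi}{5}\sum_{n\ge1}(d_{1,5}(n)-d_{4,5}(n))q^n+4\sin\tfrac{4\pi}{5}\sum_{n\ge1}(d_{2,5}(n)-d_{3,5}(n))q^n.$$ Put $\alpha=\frac{11+5\sqrt5}{2}$ and $\beta=\frac{11-5\sqrt5}{2}$. **Theorem.**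 The function $f$ is locally invertible on $\mathbb{H}$: for every $\tau\in\mathbb{H}$ there are an open set $U\ni f(\tau)$ and a holomorphic map $\sigma:U\to\mathbb{H}$ with $f(\sigma(w))=w$ for all $w\in U$ and $\sigma(f(z))=z$ for all $z$ in a neighbourhood of $\tau$. Moreover, for every open set $U\subseteq\mathbb{C}$ and every holomorphic $\sigma:U\to\mathbb{H}$ with $f(\sigma(w))=w$ on $U$, none of $0,\alpha,\beta$ lies in $U$, and the function $y(w)=S(\sigma(w))$ is holomorphic on $U$ and satisfies there the Heun differential equation $$\frac{d^2y}{dw^2}+\left\{\frac1w+\frac1{w-\alpha}+\frac1{w-\beta}\right\}\frac{dy}{dw}+\frac{w-3}{w(w-\alpha)(w-\beta)}\,y=0 .$$ -/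

import Mathlib

open scoped Topology

noncomputable section

namespace LevelFive

/-- `d_{j,k}(n)`: the number of positive divisors `d` of `n` with `d ≡ j mod k`. -/
def divCount (j k n : ℕ) : ℕ := (n.divisors.filter (fun d => d ≡ j [MOD k])).card

/-- The nome `q = exp(2πiτ)`. -/
def nome (τ : ℂ) : ℂ := Complex.exp (2 * Real.pi * Complex.I * τ)

/-- `∑_{n ≥ 1} (d_{i,5}(n) - d_{j,5}(n)) qⁿ`. -/
def divSeries (i j : ℕ) (τ : ℂ) : ℂ :=
  ∑' n : ℕ, ((divCount i 5 (n + 1) : ℂ) - (divCount j 5 (n + 1) : ℂ)) * nome τ ^ (n + 1)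

/-- `P(τ) = cot(2π/5) + 4 sin(4π/5) ∑ (d_{1,5} - d_{4,5}) qⁿ - 4 sin(2π/5) ∑ (d_{2,5} - d_{3,5}) qⁿ`. -/
def P (τ : ℂ) : ℂ :=
  (Real.cot (2 * Real.pi / 5) : ℂ)
    + 4 * (Real.sin (4 * Real.pi / 5) : ℂ) * divSeries 1 4 τ
    - 4 * (Real.sin (2 * Real.pi / 5) : ℂ) * divSeries 2 3 τ

/-- `Q(τ) = cot(π/5) + 4 sin(2π/5) ∑ (d_{1,5} - d_{4,5}) qⁿ + 4 sin(4π/5) ∑ (d_{2,5} - d_{3,5}) qⁿ`. -/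
def Q (τ : ℂ) : ℂ :=
  (Real.cot (Real.pi / 5) : ℂ)
    + 4 * (Real.sin (2 * Real.pi / 5) : ℂ) * divSeries 1 4 τ
    + 4 * (Real.sin (4 * Real.pi / 5) : ℂ) * divSeries 2 3 τ

/-- The weight-one form `S = -3P + Q`. -/
def S (τ : ℂ) : ℂ := -3 * P τ + Q τ

/-- `α = (11 + 5√5)/2`. -/
def α : ℂ := (11 + 5 * (Real.sqrt 5 : ℂ)) / 2

/-- `β = (11 - 5√5)/2`. -/
def β : ℂ := (11 - 5 * (Real.sqrt 5 : ℂ)) / 2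

/-- The level five modular function, by its `q`-product over `n ≥ 1`. -/
def f (τ : ℂ) : ℂ :=
  (11 + 5 * (Real.sqrt 5 : ℂ)) / 2 *
    ∏' n : ℕ,
      (1 + (1 + (Real.sqrt 5 : ℂ)) / 2 * nome τ ^ (n + 1) + nome τ ^ (2 * (n + 1))) ^ 5 /
      (1 + (1 - (Real.sqrt 5 : ℂ)) / 2 * nome τ ^ (n + 1) + nome τ ^ (2 * (n + 1))) ^ 5

/-- `σ` is a holomorphic branch on the open set `U` of the inverse of `f`, with values in the
upper half plane. -/
structure IsInverseBranch (σ : ℂ → ℂ) (U : Set ℂ) : Prop where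
  isOpen : IsOpen U
  differentiableOn : DifferentiableOn ℂ σ U
  im_pos : ∀ w ∈ U, 0 < (σ w).im
  right_inv : ∀ w ∈ U, f (σ w) = w

end LevelFive

end

noncomputable section

namespace LevelFive

/-! The forms `Q` and `P` are the values at u = 2π/5 and 4π/5 of `cotSeries`, a logarithmic
derivative of a theta function. Its addition theorem (`cotSeries_addition`) comes from a partial
fraction identity between the coefficients of Kronecker's series, and its right side is built from W
= `cosSeries 0 1`. The u-derivative of W is `-sinSeries 1 1`, while the τ-derivative of `sinSeries 0
0` is 2πi `sinSeries 1 1`. Differentiating the addition theorem in u therefore makes τ-derivatives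
algebraic. Doubling interchanges 2π/5 and 4π/5 up to sign and period, so `P`, `Q` and the
quasi-modular `A` satisfy a closed differential system (`fifth_relations`).

In this system `S` and `V` = P + 3Q each divide their own derivative, and the logarithmic derivative
of `f` is a quadratic form in `P` and `Q`. Comparing logarithmic derivatives and values at the cusp
gives f S = V (`f_mul_S`), whence f' = (2πi/20) f (f - α)(f - β) S² (`hasDerivAt_f'`). A solution of
a homogeneous linear equation of first order with one zero vanishes identically, so `S`, f - α and f
- β have no zeros; `f` has none because it is α times an exponential. Hence f' ≠ 0 and `f` is
locally invertible.

In the coordinate w = f(τ) one gets dS/dw = 20 L / (w(w - α)(w - β) S), with L = `logDerivS`. Since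
L satisfies a Riccati equation whose square term cancels on differentiating once more, a linear
equation for `S` remains; the numerator w - 3 comes from V - 3S = 10P. -/

/-! ### Kronecker's series and its addition theorem -/

/-- The Laurent coefficients of Kronecker's series `∑ xⁿ / (1 - qⁿ)`, with constant term `1/2`. -/
def kroneckerCoeff (q : ℂ) (n : ℤ) : ℂ := if n = 0 then 1 / 2 else 1 / (1 - q ^ n)

/-- The coefficients `qⁿ / (1 - qⁿ)²`; the one of index `0` vanishes. -/
def weightTwoCoeff (q : ℂ) (n : ℤ) : ℂ := q ^ n / (1 - q ^ n) ^ 2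

lemma one_sub_zpow_ne_zero {q : ℂ} (h1 : ‖q‖ < 1) {n : ℤ} (hn : n ≠ 0) :
    1 - q ^ n ≠ 0 := by
  intro h
  have h2 : ‖q‖ ^ n = 1 := by rw [← norm_zpow, ← sub_eq_zero.1 h, norm_one]
  exact hn ((zpow_eq_one_iff_right₀ (norm_nonneg q) h1.ne).1 h2)

/-- For a = q^i and b = q^j in general position this is the partial fraction identity 1/((1-a)(1-b))
= 1/((1-b)(1-a/b)) + 1/((1-a)(1-b/a)). The right side records the degenerate cases in which i, j or
i - j vanishes. The constant term 1/2 is what turns the diagonal case k² - 2·(1/2)·k into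
q^i/(1-q^i)². -/
lemma kroneckerCoeff_identity {q : ℂ} (h0 : q ≠ 0) (h1 : ‖q‖ < 1) (i j : ℤ) :
    kroneckerCoeff q i * kroneckerCoeff q j - kroneckerCoeff q j * kroneckerCoeff q (i - j)
      - kroneckerCoeff q i * kroneckerCoeff q (j - i)
      = (if j = 0 then weightTwoCoeff q i else 0) + (if i = 0 then weightTwoCoeff q j else 0)
        + (if i = j then weightTwoCoeff q i else 0) - (if i = 0 ∧ j = 0 then 1 / 4 else 0) := by
  have key : ∀ {n : ℤ}, n ≠ 0 → 1 - q ^ n ≠ 0 := one_sub_zpow_ne_zero h1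
  have hz : ∀ n : ℤ, q ^ n ≠ 0 := fun n => zpow_ne_zero n h0
  rcases eq_or_ne i 0 with rfl | hi <;> rcases eq_or_ne j 0 with rfl | hj
  · norm_num [kroneckerCoeff, weightTwoCoeff]
  · have hj' := key hj
    have hj2 : q ^ j - 1 ≠ 0 := by rw [← neg_ne_zero, neg_sub]; exact hj'
    have := hz j
    simp [kroneckerCoeff, weightTwoCoeff, hj, hj.symm]
    field_simp
    ring
  · have hj' := key hi
    have hj2 : q ^ i - 1 ≠ 0 := by rw [← neg_ne_zero, neg_sub]; exact hj'
    have := hz i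
    simp [kroneckerCoeff, weightTwoCoeff, hi]
    field_simp
    ring
  · rcases eq_or_ne i j with rfl | hij
    · have hj' := key hi
      simp [kroneckerCoeff, weightTwoCoeff, hi]
      field_simp
      ring
    · have h3 := key hi
      have h4 := key hj
      have h5 : q ^ i - q ^ j ≠ 0 := by
        intro h
        refine key (sub_ne_zero.2 hij) ?_
        rw [zpow_sub₀ h0, sub_eq_zero.1 h, div_self (hz j), sub_self]
      have h6 : q ^ j - q ^ i ≠ 0 := by rw [← neg_ne_zero, neg_sub]; exact h5
      have := hz i
      have := hz j
      have e1 : i - j ≠ 0 := sub_ne_zero.2 hij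
      have e2 : j - i ≠ 0 := sub_ne_zero.2 hij.symm
      simp only [kroneckerCoeff, hi, hj, e1, e2, hij, if_false, zpow_sub₀ h0, false_and]
      rw [one_sub_div (hz j), one_sub_div (hz i)]
      field_simp
      ring

/-- The functional relation behind the addition theorem of the Weierstrass zeta function: it holds
coefficient by coefficient in the Laurent expansions. -/
lemma kronecker_addition {q x y a b c a' b' c' : ℂ} (h0 : q ≠ 0) (h1 : ‖q‖ < 1)
    (hx : x ≠ 0) (hy : y ≠ 0)
    (ha : HasSum (fun n : ℤ => kroneckerCoeff q n * x ^ n) a)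
    (hb : HasSum (fun n : ℤ => kroneckerCoeff q n * y ^ n) b)
    (hc : HasSum (fun n : ℤ => kroneckerCoeff q n * (x * y) ^ n) c)
    (ha' : HasSum (fun n : ℤ => weightTwoCoeff q n * x ^ n) a')
    (hb' : HasSum (fun n : ℤ => weightTwoCoeff q n * y ^ n) b')
    (hc' : HasSum (fun n : ℤ => weightTwoCoeff q n * (x * y) ^ n) c') :
    a * b - c * (a + b) = a' + b' + c' - 1 / 4 := by
  have mul_hasSum : ∀ {u v : ℤ → ℂ} {s t : ℂ}, HasSum u s → HasSum v t →
      HasSum (fun p : ℤ × ℤ => u p.1 * v p.2) (s * t) := by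
    intro u v s t hu hv
    have := summable_mul_of_summable_norm hu.summable.norm hv.summable.norm
    exact hu.mul hv this
  have e1 := mul_hasSum ha hb
  have e2 := mul_hasSum hc ha
  have e3 := mul_hasSum hc hb
  -- The products (xy)^m x^n and (xy)^m y^n are reindexed by the exponents (i, j) of x^i y^j, so
  -- that all three double series can be compared term by term.
  let σ₂ : ℤ × ℤ ≃ ℤ × ℤ :=
    { toFun := fun p => (p.2, p.1 - p.2), invFun := fun p => (p.1 + p.2, p.1)
      left_inv := fun p => by simp, right_inv := fun p => by simp }
  let σ₃ : ℤ × ℤ ≃ ℤ × ℤ :=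
    { toFun := fun p => (p.1, p.2 - p.1), invFun := fun p => (p.1, p.1 + p.2)
      left_inv := fun p => by simp, right_inv := fun p => by simp }
  have e2' := σ₂.hasSum_iff.2 e2
  have e3' := σ₃.hasSum_iff.2 e3
  have d1 : HasSum (fun p : ℤ × ℤ => (if p.2 = 0 then weightTwoCoeff q p.1 else 0) * (x ^ p.1 * y ^ p.2)) a' := by
    have hinj : Function.Injective (fun n : ℤ => ((n, 0) : ℤ × ℤ)) := fun m n h => by simpa using h
    refine (hinj.hasSum_iff ?_).1 ?_
    · rintro ⟨i, j⟩ hp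
      have : j ≠ 0 := by rintro rfl; exact hp ⟨i, rfl⟩
      simp [this]
    · convert ha' using 2 with n
      simp
  have d2 : HasSum (fun p : ℤ × ℤ => (if p.1 = 0 then weightTwoCoeff q p.2 else 0) * (x ^ p.1 * y ^ p.2)) b' := by
    have hinj : Function.Injective (fun n : ℤ => ((0, n) : ℤ × ℤ)) := fun m n h => by simpa using h
    refine (hinj.hasSum_iff ?_).1 ?_
    · rintro ⟨i, j⟩ hp
      have : i ≠ 0 := by rintro rfl; exact hp ⟨j, rfl⟩
      simp [this]
    · convert hb' using 2 with n
      simp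
  have d3 : HasSum (fun p : ℤ × ℤ => (if p.1 = p.2 then weightTwoCoeff q p.1 else 0) * (x ^ p.1 * y ^ p.2)) c' := by
    have hinj : Function.Injective (fun n : ℤ => ((n, n) : ℤ × ℤ)) := fun m n h => by simpa using h
    refine (hinj.hasSum_iff ?_).1 ?_
    · rintro ⟨i, j⟩ hp
      have : i ≠ j := by rintro rfl; exact hp ⟨i, rfl⟩
      simp [this]
    · convert hc' using 2 with n
      simp [mul_zpow]
  have d4 : HasSum (fun p : ℤ × ℤ => (if p.1 = 0 ∧ p.2 = 0 then 1 / 4 else 0) * (x ^ p.1 * y ^ p.2)) (1 / 4 : ℂ) := by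
    convert hasSum_single ((0, 0) : ℤ × ℤ) ?_ using 1
    · simp
    · rintro ⟨i, j⟩ hp
      have : ¬ (i = 0 ∧ j = 0) := by rintro ⟨rfl, rfl⟩; exact hp rfl
      simp [this]
  have l := (e1.sub e2').sub e3'
  have r := ((d1.add d2).add d3).sub d4
  have hlr := l.unique (by
    convert r using 2 with p
    obtain ⟨i, j⟩ := p
    have := kroneckerCoeff_identity h0 h1 i j
    have hx2 : (x * y) ^ j * x ^ (i - j) = x ^ i * y ^ j := by
      rw [mul_zpow, zpow_sub₀ hx]; field_simp [zpow_ne_zero j hx]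
    have hy2 : (x * y) ^ i * y ^ (j - i) = x ^ i * y ^ j := by
      rw [mul_zpow, zpow_sub₀ hy]; field_simp [zpow_ne_zero i hy]
    simp only [Function.comp, σ₂, σ₃, Equiv.coe_fn_mk]
    linear_combination (x ^ i * y ^ j) * this - kroneckerCoeff q j * kroneckerCoeff q (i - j) * hx2
      - kroneckerCoeff q i * kroneckerCoeff q (j - i) * hy2)
  linear_combination hlr

/-- The Lambert series `∑_{n ≥ 1} qⁿ xⁿ / (1 - qⁿ)ᵏ`. -/
def lambertPower (k : ℕ) (q x : ℂ) : ℂ :=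
  ∑' n : ℕ, q ^ (n + 1) / (1 - q ^ (n + 1)) ^ k * x ^ (n + 1)

lemma norm_lambertPower_term_le (k : ℕ) {q x : ℂ} {R : ℝ} (h1 : ‖q‖ < 1) (hx : ‖x‖ ≤ R) (n : ℕ) :
    ‖q ^ (n + 1) / (1 - q ^ (n + 1)) ^ k * x ^ (n + 1)‖
      ≤ (1 - ‖q‖)⁻¹ ^ k * (‖q‖ * R) ^ (n + 1) := by
  have hq : 1 - ‖q‖ ≤ ‖1 - q ^ (n + 1)‖ := by
    have h2 : ‖q ^ (n + 1)‖ ≤ ‖q‖ := by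
      rw [norm_pow]; exact pow_le_of_le_one (norm_nonneg q) h1.le n.succ_ne_zero
    have h3 := norm_sub_norm_le (1 : ℂ) (q ^ (n + 1))
    rw [norm_one] at h3
    linarith
  have hq0 : 0 < 1 - ‖q‖ := sub_pos.2 h1
  rw [norm_mul, norm_div, norm_pow, norm_pow, norm_pow, mul_pow, div_eq_inv_mul, ← inv_pow,
    mul_assoc]
  gcongr

lemma summable_lambertPower (k : ℕ) {q x : ℂ} (h1 : ‖q‖ < 1) (hx : ‖q‖ * ‖x‖ < 1) :
    Summable fun n : ℕ => q ^ (n + 1) / (1 - q ^ (n + 1)) ^ k * x ^ (n + 1) := by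
  refine Summable.of_norm_bounded ?_ (norm_lambertPower_term_le k h1 le_rfl)
  exact ((summable_nat_add_iff 1).2 (summable_geometric_of_lt_one (by positivity) hx)).mul_left _

lemma continuousAt_lambertPower (k : ℕ) {q x : ℂ} (h1 : ‖q‖ < 1) (hx : ‖q‖ * ‖x‖ < 1) :
    ContinuousAt (lambertPower k q) x := by
  obtain ⟨R, hxR, hR⟩ : ∃ R, ‖x‖ < R ∧ ‖q‖ * R < 1 := by
    have : ∀ᶠ R in 𝓝[>] ‖x‖, ‖q‖ * R < 1 :=
      nhdsWithin_le_nhds ((continuous_const.mul continuous_id).continuousAt.eventually_lt_const hx)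
    obtain ⟨R, h1, h2⟩ := (Filter.Eventually.and (self_mem_nhdsWithin (s := Set.Ioi ‖x‖)) this).exists
    exact ⟨R, h1, h2⟩
  have hc : ContinuousOn (lambertPower k q) (Metric.ball 0 R) := by
    refine continuousOn_tsum (fun n => by fun_prop)
      (((summable_nat_add_iff 1).2 (summable_geometric_of_lt_one ?_ hR)).mul_left _)
      (fun n y hy => norm_lambertPower_term_le k h1 (by simpa using (mem_ball_zero_iff.1 hy).le) n)
    have := (norm_nonneg x).trans hxR.le
    positivity
  exact hc.continuousAt (Metric.isOpen_ball.mem_nhds (by simpa using hxR))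

/-- For n > 0 one has 1/(1-q^n) = 1 + q^n/(1-q^n) and 1/(1-q^(-n)) = -q^n/(1-q^n). Splitting off the
geometric series gives a closed form that, unlike the Laurent series, still makes sense on the unit
circle away from x = 1. -/
lemma hasSum_kroneckerCoeff {q x : ℂ} (h0 : q ≠ 0) (h1 : ‖q‖ < ‖x‖) (hx : ‖x‖ < 1) :
    HasSum (fun n : ℤ => kroneckerCoeff q n * x ^ n)
      (1 / 2 * ((1 + x) / (1 - x)) + lambertPower 1 q x - lambertPower 1 q x⁻¹) := by
  have hx0 : 0 < ‖x‖ := (norm_nonneg q).trans_lt h1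
  have hx1 : 1 - x ≠ 0 := by
    intro h; rw [← sub_eq_zero.1 h, norm_one] at hx; exact hx.false
  have hq := h1.trans hx
  have key : ∀ {n : ℤ}, n ≠ 0 → 1 - q ^ n ≠ 0 := one_sub_zpow_ne_zero hq
  have s1 : HasSum _ (lambertPower 1 q x) :=
    (summable_lambertPower 1 hq (by nlinarith [norm_nonneg q])).hasSum
  have s2 : HasSum _ (lambertPower 1 q x⁻¹) := (summable_lambertPower 1 hq
    (by rw [norm_inv, ← div_eq_mul_inv, div_lt_one hx0]; exact h1)).hasSum
  have s3 := (hasSum_geometric_of_norm_lt_one hx).mul_left x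
  have p1 : HasSum (fun n : ℕ => kroneckerCoeff q ((n : ℤ) + 1) * x ^ ((n : ℤ) + 1))
      (x * (1 - x)⁻¹ + lambertPower 1 q x) := by
    refine (congrArg (HasSum · _) (funext fun n => ?_)).mpr ((s3.add s1))
    have hk := key (n := (n : ℤ) + 1) (by omega)
    have e : (n : ℤ) + 1 = ((n + 1 : ℕ) : ℤ) := by push_cast; rfl
    rw [kroneckerCoeff, if_neg (by omega), e, zpow_natCast, zpow_natCast, pow_one]
    rw [e, zpow_natCast] at hk
    field_simp
    ring
  have p2 : HasSum (fun n : ℕ => kroneckerCoeff q (-((n : ℤ) + 1)) * x ^ (-((n : ℤ) + 1)))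
      (- lambertPower 1 q x⁻¹) := by
    refine (congrArg (HasSum · _) (funext fun n => ?_)).mpr (s2.neg)
    have hk := key (n := (n : ℤ) + 1) (by omega)
    have e : (n : ℤ) + 1 = ((n + 1 : ℕ) : ℤ) := by push_cast; rfl
    rw [kroneckerCoeff, if_neg (by omega), e, zpow_neg, zpow_neg, zpow_natCast, zpow_natCast,
      pow_one, inv_pow, ← neg_mul]
    rw [e, zpow_natCast] at hk
    have hk2 : q ^ (n + 1) - 1 ≠ 0 := by rw [← neg_ne_zero, neg_sub]; exact hk
    have hq2 : q ^ (n + 1) ≠ 0 := pow_ne_zero _ h0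
    congr 1
    rw [show 1 - (q ^ (n + 1))⁻¹ = -(1 - q ^ (n + 1)) / q ^ (n + 1) by field_simp; ring,
      one_div_div, div_neg]
  have := HasSum.of_add_one_of_neg_add_one (f := fun n : ℤ => kroneckerCoeff q n * x ^ n) p1 p2
  have e : 1 / 2 * ((1 + x) / (1 - x)) = x * (1 - x)⁻¹ + 1 / 2 := by field_simp; ring
  rw [show 1 / 2 * ((1 + x) / (1 - x)) + lambertPower 1 q x - lambertPower 1 q x⁻¹
    = x * (1 - x)⁻¹ + lambertPower 1 q x + kroneckerCoeff q 0 * x ^ (0 : ℤ)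
      + -lambertPower 1 q x⁻¹ by rw [e]; simp only [kroneckerCoeff, if_true, zpow_zero]; ring]
  exact this

lemma hasSum_weightTwoCoeff {q x : ℂ} (h0 : q ≠ 0) (hq : ‖q‖ < 1) (h1 : ‖q‖ * ‖x‖ < 1)
    (hx : ‖q‖ * ‖x⁻¹‖ < 1) :
    HasSum (fun n : ℤ => weightTwoCoeff q n * x ^ n)
      (lambertPower 2 q x + lambertPower 2 q x⁻¹) := by
  have key : ∀ {n : ℤ}, n ≠ 0 → 1 - q ^ n ≠ 0 := one_sub_zpow_ne_zero hq
  have s1 : HasSum _ (lambertPower 2 q x) := (summable_lambertPower 2 hq h1).hasSum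
  have s2 : HasSum _ (lambertPower 2 q x⁻¹) := (summable_lambertPower 2 hq hx).hasSum
  have p1 : HasSum (fun n : ℕ => weightTwoCoeff q ((n : ℤ) + 1) * x ^ ((n : ℤ) + 1))
      (lambertPower 2 q x) := by
    refine (congrArg (HasSum · _) (funext fun n => ?_)).mpr (s1)
    have e : (n : ℤ) + 1 = ((n + 1 : ℕ) : ℤ) := by push_cast; rfl
    rw [weightTwoCoeff, e, zpow_natCast, zpow_natCast]
  have p2 : HasSum (fun n : ℕ => weightTwoCoeff q (-((n : ℤ) + 1)) * x ^ (-((n : ℤ) + 1)))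
      (lambertPower 2 q x⁻¹) := by
    refine (congrArg (HasSum · _) (funext fun n => ?_)).mpr (s2)
    have hk := key (n := (n : ℤ) + 1) (by omega)
    have e : (n : ℤ) + 1 = ((n + 1 : ℕ) : ℤ) := by push_cast; rfl
    rw [weightTwoCoeff, e, zpow_neg, zpow_neg, zpow_natCast, zpow_natCast, inv_pow]
    rw [e, zpow_natCast] at hk
    have hq2 : q ^ (n + 1) ≠ 0 := pow_ne_zero _ h0
    congr 1
    rw [show 1 - (q ^ (n + 1))⁻¹ = -(1 - q ^ (n + 1)) / q ^ (n + 1) by field_simp; ring]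
    field_simp
  have := HasSum.of_add_one_of_neg_add_one (f := fun n : ℤ => weightTwoCoeff q n * x ^ n) p1 p2
  rw [show weightTwoCoeff q 0 * x ^ (0 : ℤ) = 0 by simp [weightTwoCoeff], add_zero] at this
  exact this

/-- Kronecker's series on the unit circle and near it. -/
def kroneckerSeries (q x : ℂ) : ℂ :=
  1 / 2 * ((1 + x) / (1 - x)) + lambertPower 1 q x - lambertPower 1 q x⁻¹

lemma continuousAt_kroneckerSeries {q x : ℂ} (h1 : ‖q‖ < 1) (hx : ‖x‖ = 1) (hx1 : x ≠ 1) :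
    ContinuousAt (kroneckerSeries q) x := by
  have hx0 : x ≠ 0 := by rintro rfl; simp at hx
  have c1 := continuousAt_lambertPower 1 (q := q) (x := x) h1 (by simpa [hx] using h1)
  have c2 := continuousAt_lambertPower 1 (q := q) (x := x⁻¹) h1 (by simpa [hx] using h1)
  have c3 : ContinuousAt (fun y : ℂ => 1 / 2 * ((1 + y) / (1 - y))) x :=
    continuousAt_const.mul (ContinuousAt.div (by fun_prop) (by fun_prop) (sub_ne_zero.2 hx1.symm))
  exact (c3.add c1).sub (ContinuousAt.comp (f := fun y : ℂ => y⁻¹) c2 (continuousAt_inv₀ hx0))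

lemma continuousAt_lambertPower_add_inv {q x : ℂ} (k : ℕ) (h1 : ‖q‖ < 1) (hx : ‖x‖ = 1) :
    ContinuousAt (fun y => lambertPower k q y + lambertPower k q y⁻¹) x := by
  have hx0 : x ≠ 0 := by rintro rfl; simp at hx
  have c1 := continuousAt_lambertPower k (q := q) (x := x) h1 (by simpa [hx] using h1)
  have c2 := continuousAt_lambertPower k (q := q) (x := x⁻¹) h1 (by simpa [hx] using h1)
  exact c1.add (ContinuousAt.comp (f := fun y : ℂ => y⁻¹) c2 (continuousAt_inv₀ hx0))

/-- The Laurent expansions are available only for |q| < |x| < 1. The relation is proved at sx, sy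
and s²xy and carried to the unit circle by letting s increase to 1. -/
lemma kroneckerSeries_addition {q x y : ℂ} (h0 : q ≠ 0) (h1 : ‖q‖ < 1) (hx : ‖x‖ = 1)
    (hy : ‖y‖ = 1) (hx1 : x ≠ 1) (hy1 : y ≠ 1) (hxy1 : x * y ≠ 1) :
    kroneckerSeries q x * kroneckerSeries q y
        - kroneckerSeries q (x * y) * (kroneckerSeries q x + kroneckerSeries q y)
      = (lambertPower 2 q x + lambertPower 2 q x⁻¹) + (lambertPower 2 q y + lambertPower 2 q y⁻¹)
        + (lambertPower 2 q (x * y) + lambertPower 2 q (x * y)⁻¹) - 1 / 4 := by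
  have hxy : ‖x * y‖ = 1 := by rw [norm_mul, hx, hy, one_mul]
  have lim : ∀ (z : ℂ) (m : ℕ), Filter.Tendsto (fun s : ℝ => (s : ℂ) ^ m * z) (𝓝[<] 1) (𝓝 z) := by
    intro z m
    have : Filter.Tendsto (fun s : ℝ => (s : ℂ) ^ m * z) (𝓝 1) (𝓝 (((1 : ℝ) : ℂ) ^ m * z)) :=
      Continuous.tendsto (by fun_prop) 1
    simpa using this.mono_left nhdsWithin_le_nhds
  have R : ∀ (z : ℂ) (m : ℕ), ‖z‖ = 1 → z ≠ 1 →
      Filter.Tendsto (fun s : ℝ => kroneckerSeries q ((s : ℂ) ^ m * z)) (𝓝[<] 1)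
        (𝓝 (kroneckerSeries q z)) := fun z m hz hz1 =>
    (continuousAt_kroneckerSeries h1 hz hz1).tendsto.comp (lim z m)
  have N : ∀ (z : ℂ) (m : ℕ), ‖z‖ = 1 →
      Filter.Tendsto (fun s : ℝ => lambertPower 2 q ((s : ℂ) ^ m * z)
        + lambertPower 2 q ((s : ℂ) ^ m * z)⁻¹) (𝓝[<] 1)
        (𝓝 (lambertPower 2 q z + lambertPower 2 q z⁻¹)) := fun z m hz =>
    (continuousAt_lambertPower_add_inv 2 h1 hz).tendsto.comp (lim z m)
  refine tendsto_nhds_unique_of_eventuallyEq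
    (((R x 1 hx hx1).mul (R y 1 hy hy1)).sub
      ((R (x * y) 2 hxy hxy1).mul ((R x 1 hx hx1).add (R y 1 hy hy1))))
    ((((N x 1 hx).add (N y 1 hy)).add (N (x * y) 2 hxy)).sub_const (1 / 4)) ?_
  -- The bound on s² keeps the product s²xy, the smallest of the three points, inside the annulus.
  have ev : ∀ᶠ s : ℝ in 𝓝[<] 1, ‖q‖ < s ^ 2 ∧ 0 < s := by
    have h2 : ContinuousAt (fun s : ℝ => s ^ 2) 1 := by fun_prop
    refine nhdsWithin_le_nhds ?_
    exact (h2.eventually_const_lt (by simpa using h1)).and (lt_mem_nhds one_pos)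
  filter_upwards [ev, self_mem_nhdsWithin] with s ⟨hs, hs0⟩ hs1
  have hs1 : s < 1 := hs1
  have hs2 : s ^ 2 < s := by nlinarith
  have nrm : ∀ (z : ℂ) (m : ℕ), ‖z‖ = 1 → ‖(s : ℂ) ^ m * z‖ = s ^ m := by
    intro z m hz
    rw [norm_mul, norm_pow, hz, Complex.norm_real, Real.norm_of_nonneg hs0.le, mul_one]
  have e : (s : ℂ) ^ 2 * (x * y) = (s : ℂ) ^ 1 * x * ((s : ℂ) ^ 1 * y) := by ring
  have nz : ∀ (z : ℂ) (m : ℕ), ‖z‖ = 1 → (s : ℂ) ^ m * z ≠ 0 := by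
    intro z m hz h
    have := nrm z m hz
    rw [h, norm_zero] at this
    exact (pow_pos hs0 m).ne this
  have A : ∀ (z : ℂ) (m : ℕ), ‖z‖ = 1 → ‖q‖ < s ^ m → s ^ m < 1 →
      HasSum (fun n : ℤ => kroneckerCoeff q n * ((s : ℂ) ^ m * z) ^ n)
        (kroneckerSeries q ((s : ℂ) ^ m * z)) ∧
      HasSum (fun n : ℤ => weightTwoCoeff q n * ((s : ℂ) ^ m * z) ^ n)
        (lambertPower 2 q ((s : ℂ) ^ m * z) + lambertPower 2 q ((s : ℂ) ^ m * z)⁻¹) := by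
    intro z m hz hqm hm
    have hsm : 0 < s ^ m := pow_pos hs0 m
    refine ⟨hasSum_kroneckerCoeff h0 (by rwa [nrm z m hz]) (by rwa [nrm z m hz]),
      hasSum_weightTwoCoeff h0 h1 ?_ ?_⟩
    · rw [nrm z m hz]; nlinarith [norm_nonneg q]
    · rw [norm_inv, nrm z m hz, ← div_eq_mul_inv, div_lt_one hsm]; exact hqm
  have Ax := A x 1 hx (by rw [pow_one]; linarith) (by rwa [pow_one])
  have Ay := A y 1 hy (by rw [pow_one]; linarith) (by rwa [pow_one])
  have Axy := A (x * y) 2 hxy hs (by linarith)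
  refine kronecker_addition h0 h1 (nz x 1 hx) (nz y 1 hy) Ax.1 Ay.1 ?_ Ax.2 Ay.2 ?_
  · rw [← e]; exact Axy.1
  · rw [← e]; exact Axy.2

/-! ### Lambert double series and their derivatives in u and τ -/

/-- The double series `∑_{d, e ≥ 1} w(d, e) q^{de}`. -/
def lambert (w : ℕ+ → ℕ+ → ℂ) (q : ℂ) : ℂ :=
  ∑' p : ℕ+ × ℕ+, w p.1 p.2 * q ^ (p.1 * p.2 : ℕ)

/-- Polynomial growth of a family of coefficients, uniform in a parameter. -/
def PolyBounded {ι : Type*} (w : ι → ℕ+ → ℕ+ → ℂ) : Prop :=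
  ∃ (C : ℝ) (k : ℕ), ∀ i d e, ‖w i d e‖ ≤ C * ((d : ℝ) * e) ^ k

lemma summable_pow_mul_pow_prod (k : ℕ) {r : ℝ} (h0 : 0 ≤ r) (h1 : r < 1) :
    Summable fun p : ℕ+ × ℕ+ => ((p.1 : ℝ) * p.2) ^ k * r ^ (p.1 * p.2 : ℕ) := by
  -- An intermediate ratio s absorbs the polynomial factor: n^k (r/s)^n is bounded, which leaves the
  -- convergent sum of s^{de}.
  obtain ⟨s, hrs, hs⟩ := exists_between h1
  have hs0 : 0 < s := h0.trans_lt hrs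
  have ht := tendsto_pow_const_mul_const_pow_of_lt_one k (div_nonneg h0 hs0.le)
    ((div_lt_one hs0).2 hrs)
  obtain ⟨C, hC⟩ := ht.bddAbove_range
  have hsum := summable_prod_mul_pow (𝕜 := ℝ) 0 (r := s) (by rwa [Real.norm_of_nonneg hs0.le])
  refine Summable.of_nonneg_of_le (fun p => by positivity) (fun p => ?_) (hsum.mul_left C)
  have h := hC ⟨(p.1 * p.2 : ℕ), rfl⟩
  dsimp only at h
  rw [div_pow, ← mul_div_assoc, div_le_iff₀ (by positivity)] at h
  push_cast at h ⊢
  simpa using h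

lemma PolyBounded.exists_norm_term_le {ι : Type*} {w : ι → ℕ+ → ℕ+ → ℂ} (hw : PolyBounded w)
    {r : ℝ} (h0 : 0 ≤ r) (h1 : r < 1) :
    ∃ m : ℕ+ × ℕ+ → ℝ, Summable m ∧ ∀ i (q : ℂ), ‖q‖ ≤ r → ∀ p : ℕ+ × ℕ+,
      ‖w i p.1 p.2 * q ^ (p.1 * p.2 : ℕ)‖ ≤ m p := by
  obtain ⟨C, k, h⟩ := hw
  refine ⟨_, (summable_pow_mul_pow_prod k h0 h1).mul_left C, fun i q hq p => ?_⟩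
  rw [norm_mul, norm_pow, ← mul_assoc]
  have := (norm_nonneg _).trans (h i p.1 p.2)
  exact mul_le_mul (h i p.1 p.2) (by gcongr) (by positivity) this

lemma PolyBounded.summable {ι : Type*} {w : ι → ℕ+ → ℕ+ → ℂ} (hw : PolyBounded w) (i : ι)
    {q : ℂ} (h1 : ‖q‖ < 1) : Summable fun p : ℕ+ × ℕ+ => w i p.1 p.2 * q ^ (p.1 * p.2 : ℕ) := by
  obtain ⟨m, hm, h⟩ := hw.exists_norm_term_le (norm_nonneg q) h1
  exact Summable.of_norm_bounded hm (h i q le_rfl)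

lemma hasDerivAt_lambert_param {w w' : ℝ → ℕ+ → ℕ+ → ℂ} (hw : PolyBounded w)
    (hw' : PolyBounded w') (h : ∀ u d e, HasDerivAt (fun u => w u d e) (w' u d e) u)
    {q : ℂ} (h1 : ‖q‖ < 1) (u : ℝ) :
    HasDerivAt (fun u => lambert (w u) q) (lambert (w' u) q) u := by
  obtain ⟨m, hm, hb⟩ := hw'.exists_norm_term_le (norm_nonneg q) h1
  exact hasDerivAt_tsum hm (fun p u => (h u p.1 p.2).mul_const _) (fun p u => hb u q le_rfl p)
    (hw.summable 0 h1) u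

lemma norm_nome (τ : ℂ) : ‖nome τ‖ = Real.exp (-(2 * Real.pi * τ.im)) := by
  rw [nome, Complex.norm_exp]; simp

lemma norm_nome_lt_one {τ : ℂ} (h : 0 < τ.im) : ‖nome τ‖ < 1 := by
  rw [norm_nome, Real.exp_lt_one_iff, neg_lt_zero]; positivity

lemma nome_ne_zero (τ : ℂ) : nome τ ≠ 0 := Complex.exp_ne_zero _

lemma hasDerivAt_nome (τ : ℂ) : HasDerivAt nome (2 * Real.pi * Complex.I * nome τ) τ := by
  have := ((hasDerivAt_id τ).const_mul (2 * Real.pi * Complex.I)).cexp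
  exact this.congr_deriv (by rw [nome, mul_one, mul_comm, id])

lemma hasDerivAt_lambert_nome {w : ℕ+ → ℕ+ → ℂ} (hw : PolyBounded fun _ : Unit => w) {τ : ℂ}
    (hτ : 0 < τ.im) :
    HasDerivAt (fun τ => lambert w (nome τ))
      (2 * Real.pi * Complex.I * lambert (fun d e => d * e * w d e) (nome τ)) τ := by
  have hw' : PolyBounded fun (_ : Unit) (d e : ℕ+) => 2 * Real.pi * Complex.I * (d * e * w d e) := by
    obtain ⟨C, k, h⟩ := hw
    refine ⟨2 * Real.pi * C, k + 1, fun i d e => ?_⟩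
    have := h i d e
    rw [norm_mul, norm_mul, norm_mul]
    simp only [norm_mul, Complex.norm_ofNat, Complex.norm_real, Complex.norm_I,
      Real.norm_of_nonneg Real.pi_pos.le, Complex.norm_natCast, mul_one]
    rw [pow_succ]
    calc _ ≤ 2 * Real.pi * ((d : ℝ) * e * (C * ((d : ℝ) * e) ^ k)) := by gcongr
      _ = _ := by ring
  -- On the half plane Im z > Im τ / 2 the nome stays in a fixed disc of radius less than 1, which
  -- gives one summable majorant for all derivatives.
  have hr : ∀ z : ℂ, τ.im / 2 < z.im → ‖nome z‖ ≤ Real.exp (-(2 * Real.pi * (τ.im / 2))) := by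
    intro z hz
    rw [norm_nome]
    gcongr
  have hr1 : Real.exp (-(2 * Real.pi * (τ.im / 2))) < 1 := by
    rw [Real.exp_lt_one_iff, neg_lt_zero]; positivity
  obtain ⟨m, hm, hb⟩ := hw'.exists_norm_term_le (Real.exp_nonneg _) hr1
  have hopen : IsOpen {z : ℂ | τ.im / 2 < z.im} := isOpen_lt continuous_const Complex.continuous_im
  have hconn : IsPreconnected {z : ℂ | τ.im / 2 < z.im} :=
    (convex_halfSpace_im_gt _).isPreconnected
  have key := hasDerivAt_tsum_of_isPreconnected
    (g := fun (p : ℕ+ × ℕ+) z => w p.1 p.2 * nome z ^ (p.1 * p.2 : ℕ))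
    (g' := fun (p : ℕ+ × ℕ+) z =>
      2 * Real.pi * Complex.I * (p.1 * p.2 * w p.1 p.2) * nome z ^ (p.1 * p.2 : ℕ))
    (y := τ) (y₀ := τ) hm hopen hconn
    (fun p z _ => by
      refine (((hasDerivAt_nome z).fun_pow (p.1 * p.2 : ℕ)).const_mul (w p.1 p.2)).congr_deriv ?_
      have : (p.1 * p.2 : ℕ) ≠ 0 := (mul_pos p.1.pos p.2.pos).ne'
      obtain ⟨n, hn⟩ := Nat.exists_eq_succ_of_ne_zero this
      have hn' : (p.1 : ℂ) * (p.2 : ℂ) = n + 1 := by exact_mod_cast hn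
      rw [hn', hn, Nat.succ_eq_add_one, Nat.add_sub_cancel, pow_succ]
      push_cast
      ring)
    (fun p z hz => hb () _ (hr z hz) p)
    (half_lt_self hτ) (hw.summable () (norm_nome_lt_one hτ))
    (half_lt_self hτ)
  refine key.congr_deriv ?_
  rw [lambert, ← tsum_mul_left]
  exact tsum_congr fun p => by ring

lemma lambert_eq_tsum_tsum {w : ℕ+ → ℕ+ → ℂ} (hw : PolyBounded fun _ : Unit => w) {q : ℂ}
    (h1 : ‖q‖ < 1) :
    lambert w q = ∑' d : ℕ+, ∑' e : ℕ+, w d e * q ^ (d * e : ℕ) :=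
  (hw.summable () h1).tsum_prod

lemma lambert_const_mul (c : ℂ) (w : ℕ+ → ℕ+ → ℂ) (q : ℂ) :
    lambert (fun d e => c * w d e) q = c * lambert w q := by
  rw [lambert, lambert, ← tsum_mul_left]
  exact tsum_congr fun p => by ring

lemma lambert_add {v w : ℕ+ → ℕ+ → ℂ} (hv : PolyBounded fun _ : Unit => v)
    (hw : PolyBounded fun _ : Unit => w) {q : ℂ} (h1 : ‖q‖ < 1) :
    lambert (fun d e => v d e + w d e) q = lambert v q + lambert w q := by
  rw [lambert, lambert, lambert, ← (hv.summable () h1).tsum_add (hw.summable () h1)]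
  exact tsum_congr fun p => by ring

lemma polyBounded_ofReal {ι : Type*} (n : ℕ) {g : ι → ℕ+ → ℕ+ → ℝ}
    {C : ℝ} (hg : ∀ i d e, |g i d e| ≤ C * ((d : ℝ) * e) ^ n) :
    PolyBounded fun i d e => ((g i d e : ℝ) : ℂ) :=
  ⟨C, n, fun i d e => by rw [Complex.norm_real, Real.norm_eq_abs]; exact hg i d e⟩

lemma lambertPower_one_eq_lambert {q x : ℂ} (h1 : ‖q‖ < 1) (hx : ‖x‖ = 1) :
    lambertPower 1 q x = lambert (fun d _ => x ^ (d : ℕ)) q := by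
  rw [lambert_eq_tsum_tsum ⟨1, 0, fun i d e => by simp [hx]⟩ h1, lambertPower,
    ← tsum_pnat_eq_tsum_succ (f := fun n => q ^ n / (1 - q ^ n) ^ 1 * x ^ n)]
  refine tsum_congr fun d => ?_
  have hd : ‖q ^ (d : ℕ)‖ < 1 := by rw [norm_pow]; exact pow_lt_one₀ (norm_nonneg _) h1 d.ne_zero
  have h2 := tsum_pnat_eq_tsum_succ (f := fun e => x ^ (d : ℕ) * q ^ (d * e : ℕ))
  rw [h2]
  simp_rw [pow_mul, pow_succ, ← mul_assoc]
  rw [tsum_mul_right, tsum_mul_left, tsum_geometric_of_norm_lt_one hd]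
  ring

lemma lambertPower_two_eq_lambert {q x : ℂ} (h1 : ‖q‖ < 1) (hx : ‖x‖ = 1) :
    lambertPower 2 q x = lambert (fun d e => e * x ^ (d : ℕ)) q := by
  have hb : PolyBounded fun (_ : Unit) (d e : ℕ+) => (e : ℂ) * x ^ (d : ℕ) := by
    refine ⟨1, 1, fun i d e => ?_⟩
    have : (1 : ℝ) ≤ d := mod_cast d.pos
    rw [norm_mul, norm_pow, hx, one_pow, mul_one, Complex.norm_natCast, one_mul, pow_one]
    exact le_mul_of_one_le_left (Nat.cast_nonneg _) this
  rw [lambert_eq_tsum_tsum hb h1, lambertPower,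
    ← tsum_pnat_eq_tsum_succ (f := fun n => q ^ n / (1 - q ^ n) ^ 2 * x ^ n)]
  refine tsum_congr fun d => ?_
  have hd : ‖q ^ (d : ℕ)‖ < 1 := by rw [norm_pow]; exact pow_lt_one₀ (norm_nonneg _) h1 d.ne_zero
  have h3 := (hasSum_coe_mul_geometric_of_norm_lt_one hd)
  have h2 := tsum_zero_pnat_eq_tsum_nat h3.summable
  rw [h3.tsum_eq] at h2
  rw [← h2]
  simp only [Nat.cast_zero, zero_mul, zero_add]
  rw [← tsum_mul_right]
  refine tsum_congr fun e => ?_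
  rw [pow_mul]
  ring

/-- `∑_{d, e ≥ 1} dᵃ eᵇ sin(du) q^{de}`. -/
def sinSeries (a b : ℕ) (q : ℂ) (u : ℝ) : ℂ :=
  lambert (fun d e => (((d : ℝ) ^ a * (e : ℝ) ^ b * Real.sin (d * u) : ℝ) : ℂ)) q

/-- `∑_{d, e ≥ 1} dᵃ eᵇ cos(du) q^{de}`. -/
def cosSeries (a b : ℕ) (q : ℂ) (u : ℝ) : ℂ :=
  lambert (fun d e => (((d : ℝ) ^ a * (e : ℝ) ^ b * Real.cos (d * u) : ℝ) : ℂ)) q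

lemma polyBounded_monomial {ι : Type*} (a b : ℕ) {t : ι → ℕ+ → ℝ} (ht : ∀ i d, |t i d| ≤ 1) :
    PolyBounded fun i (d e : ℕ+) => (((d : ℝ) ^ a * (e : ℝ) ^ b * t i d : ℝ) : ℂ) := by
  refine polyBounded_ofReal (max a b) (C := 1) fun i d e => ?_
  have hd : (1 : ℝ) ≤ d := mod_cast d.pos
  have he : (1 : ℝ) ≤ e := mod_cast e.pos
  rw [abs_mul, abs_of_nonneg (by positivity), one_mul, mul_pow]
  refine (mul_le_of_le_one_right (by positivity) (ht i d)).trans ?_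
  gcongr
  · exact le_max_left a b
  · exact le_max_right a b

lemma polyBounded_sin (a b : ℕ) : PolyBounded fun (u : ℝ) (d e : ℕ+) =>
    (((d : ℝ) ^ a * (e : ℝ) ^ b * Real.sin (d * u) : ℝ) : ℂ) :=
  polyBounded_monomial a b (t := fun u d => Real.sin (d * u)) fun _ _ => Real.abs_sin_le_one _

lemma polyBounded_cos (a b : ℕ) : PolyBounded fun (u : ℝ) (d e : ℕ+) =>
    (((d : ℝ) ^ a * (e : ℝ) ^ b * Real.cos (d * u) : ℝ) : ℂ) :=
  polyBounded_monomial a b (t := fun u d => Real.cos (d * u)) fun _ _ => Real.abs_cos_le_one _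

lemma PolyBounded.apply {ι : Type*} {w : ι → ℕ+ → ℕ+ → ℂ} (hw : PolyBounded w) (i : ι) :
    PolyBounded fun _ : Unit => w i := by
  obtain ⟨C, k, h⟩ := hw
  exact ⟨C, k, fun _ => h i⟩

lemma hasDerivAt_sinSeries (a b : ℕ) {q : ℂ} (h1 : ‖q‖ < 1) (u : ℝ) :
    HasDerivAt (sinSeries a b q) (cosSeries (a + 1) b q u) u := by
  refine hasDerivAt_lambert_param (polyBounded_sin a b) (polyBounded_cos (a + 1) b)
    (fun u d e => ?_) h1 u
  refine HasDerivAt.ofReal_comp ?_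
  refine ((((hasDerivAt_id u).const_mul (d : ℝ)).sin).const_mul _).congr_deriv ?_
  simp only [id]; ring

lemma hasDerivAt_cosSeries (a b : ℕ) {q : ℂ} (h1 : ‖q‖ < 1) (u : ℝ) :
    HasDerivAt (cosSeries a b q) (-sinSeries (a + 1) b q u) u := by
  have hneg : PolyBounded fun (u : ℝ) (d e : ℕ+) =>
      (((d : ℝ) ^ (a + 1) * (e : ℝ) ^ b * -Real.sin (d * u) : ℝ) : ℂ) :=
    polyBounded_monomial (a + 1) b (t := fun u d => -Real.sin (d * u))
      fun u d => by rw [abs_neg]; exact Real.abs_sin_le_one _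
  refine (hasDerivAt_lambert_param (polyBounded_cos a b) hneg (fun u d e => ?_) h1 u).congr_deriv ?_
  · refine HasDerivAt.ofReal_comp ?_
    refine ((((hasDerivAt_id u).const_mul (d : ℝ)).cos).const_mul _).congr_deriv ?_
    simp only [id]; ring
  · rw [sinSeries, ← neg_one_mul, ← lambert_const_mul]
    congr 1
    funext d e
    push_cast
    ring

/-- Differentiation in τ brings down 2πi·de, whereas differentiation in u brings down d only. For a
= b = 0 the result is, up to a factor, the u-derivative of `cosSeries 0 1`, which is how the
addition theorem comes to govern τ-derivatives. -/
lemma hasDerivAt_sinSeries_nome (a b : ℕ) {τ : ℂ} (hτ : 0 < τ.im) (u : ℝ) :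
    HasDerivAt (fun τ => sinSeries a b (nome τ) u)
      (2 * Real.pi * Complex.I * sinSeries (a + 1) (b + 1) (nome τ) u) τ := by
  refine (hasDerivAt_lambert_nome ((polyBounded_sin a b).apply u) hτ).congr_deriv ?_
  rw [sinSeries]
  congr 2
  funext d e
  push_cast
  ring

lemma hasDerivAt_cosSeries_nome (a b : ℕ) {τ : ℂ} (hτ : 0 < τ.im) (u : ℝ) :
    HasDerivAt (fun τ => cosSeries a b (nome τ) u)
      (2 * Real.pi * Complex.I * cosSeries (a + 1) (b + 1) (nome τ) u) τ := by
  refine (hasDerivAt_lambert_nome ((polyBounded_cos a b).apply u) hτ).congr_deriv ?_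
  rw [cosSeries]
  congr 2
  funext d e
  push_cast
  ring

lemma sinSeries_neg (a b : ℕ) (q : ℂ) (u : ℝ) : sinSeries a b q (-u) = -sinSeries a b q u := by
  rw [sinSeries, sinSeries, ← neg_one_mul (lambert _ q), ← lambert_const_mul]
  congr 1
  funext d e
  rw [mul_neg, Real.sin_neg]
  push_cast
  ring

lemma cosSeries_neg (a b : ℕ) (q : ℂ) (u : ℝ) : cosSeries a b q (-u) = cosSeries a b q u := by
  simp only [cosSeries, mul_neg, Real.cos_neg]

lemma sinSeries_add_two_pi (a b : ℕ) (q : ℂ) (u : ℝ) :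
    sinSeries a b q (u + 2 * Real.pi) = sinSeries a b q u := by
  simp only [sinSeries, mul_add, Real.sin_add_nat_mul_two_pi]

lemma cosSeries_add_two_pi (a b : ℕ) (q : ℂ) (u : ℝ) :
    cosSeries a b q (u + 2 * Real.pi) = cosSeries a b q u := by
  simp only [cosSeries, mul_add, Real.cos_add_nat_mul_two_pi]

/-! ### Addition theorem and Riccati equation of `cotSeries` -/

/-- The logarithmic derivative of the Jacobi theta function, `cot(u/2) + 4 ∑ sin(du) q^{de}`. -/
def cotSeries (q : ℂ) (u : ℝ) : ℂ := (Real.cot (u / 2) : ℂ) + 4 * sinSeries 0 0 q u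

/-- The derivative of `cotSeries` in `u`. -/
def cotSeriesDeriv (q : ℂ) (u : ℝ) : ℂ :=
  -(1 + (Real.cot (u / 2) : ℂ) ^ 2) / 2 + 4 * cosSeries 1 0 q u

lemma hasDerivAt_cotSeries {q : ℂ} (h1 : ‖q‖ < 1) {u : ℝ} (hu : Real.sin (u / 2) ≠ 0) :
    HasDerivAt (cotSeries q) (cotSeriesDeriv q u) u := by
  refine HasDerivAt.add ?_ ((hasDerivAt_sinSeries 0 0 h1 u).const_mul 4)
  have h2 : HasDerivAt (fun u : ℝ => Real.cot (u / 2)) (-(1 + Real.cot (u / 2) ^ 2) / 2) u := by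
    have hd := (hasDerivAt_id u).div_const 2
    simp_rw [Real.cot_eq_cos_div_sin]
    refine (hd.cos.div hd.sin hu).congr_deriv ?_
    simp only [id]
    field_simp
    ring
  exact h2.ofReal_comp.congr_deriv (by push_cast; ring)

/-- The half-angle formula (1 + e^{iu})/(1 - e^{iu}) = i cot(u/2) handles the elementary part, and
the two Lambert series combine into sines. -/
lemma kroneckerSeries_exp {q : ℂ} (h1 : ‖q‖ < 1) {u : ℝ} (hu : Real.sin (u / 2) ≠ 0) :
    kroneckerSeries q (Complex.exp (u * Complex.I)) = Complex.I / 2 * cotSeries q u := by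
  have hn : ‖Complex.exp (u * Complex.I)‖ = 1 := Complex.norm_exp_ofReal_mul_I u
  have hn' : ‖(Complex.exp (u * Complex.I))⁻¹‖ = 1 := by rw [norm_inv, hn, inv_one]
  have hs : sinSeries 0 0 q u = 1 / (2 * Complex.I) *
      (lambertPower 1 q (Complex.exp (u * Complex.I))
        - lambertPower 1 q (Complex.exp (u * Complex.I))⁻¹) := by
    rw [lambertPower_one_eq_lambert h1 hn, lambertPower_one_eq_lambert h1 hn', sub_eq_add_neg,
      ← neg_one_mul (lambert _ q), ← lambert_const_mul (-1), ← lambert_add, ← lambert_const_mul,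
      sinSeries]
    · congr 1
      funext d e
      rw [← Complex.exp_neg, ← Complex.exp_nat_mul, ← Complex.exp_nat_mul]
      simp only [pow_zero, one_mul, Complex.ofReal_sin, Complex.sin, Complex.ofReal_mul,
        Complex.ofReal_natCast]
      have hI := Complex.I_ne_zero
      field_simp
      rw [Complex.I_sq]
      ring_nf
    · exact ⟨1, 0, fun i d e => by simp [hn]⟩
    · exact ⟨1, 0, fun i d e => by simp [hn]⟩
    · exact h1
  have hc : 1 / 2 * ((1 + Complex.exp (u * Complex.I)) / (1 - Complex.exp (u * Complex.I)))
      = Complex.I / 2 * (Real.cot (u / 2) : ℂ) := by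
    have e : Complex.exp (u * Complex.I) = (Complex.cos ((u / 2 : ℝ) : ℂ)
        + Complex.sin ((u / 2 : ℝ) : ℂ) * Complex.I) ^ 2 := by
      rw [← Complex.exp_mul_I, ← Complex.exp_nat_mul]
      congr 1; push_cast; ring
    have hsc := Complex.cos_sq_add_sin_sq ((u / 2 : ℝ) : ℂ)
    have hs0 : Complex.sin ((u / 2 : ℝ) : ℂ) ≠ 0 := by rwa [← Complex.ofReal_sin, Complex.ofReal_ne_zero]
    have hne : Complex.cos ((u / 2 : ℝ) : ℂ) + Complex.sin ((u / 2 : ℝ) : ℂ) * Complex.I ≠ 0 := by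
      rw [← Complex.exp_mul_I]; exact Complex.exp_ne_zero _
    rw [Real.cot_eq_cos_div_sin, Complex.ofReal_div, Complex.ofReal_cos, Complex.ofReal_sin, e]
    set c := Complex.cos ((u / 2 : ℝ) : ℂ)
    set s := Complex.sin ((u / 2 : ℝ) : ℂ)
    have hI := Complex.I_sq
    have e1 : 1 + (c + s * Complex.I) ^ 2 = 2 * c * (c + s * Complex.I) := by
      linear_combination -hsc - s ^ 2 * (-hI)
    have e2 : 1 - (c + s * Complex.I) ^ 2 = -(2 * Complex.I * s) * (c + s * Complex.I) := by
      linear_combination -hsc + s ^ 2 * hI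
    have hI0 := Complex.I_ne_zero
    rw [e1, e2]
    field_simp
    linear_combination -c * hI
  rw [kroneckerSeries, hc, cotSeries, hs]
  have hI0 := Complex.I_ne_zero
  field_simp
  ring

lemma lambertPower_two_exp {q : ℂ} (h1 : ‖q‖ < 1) (u : ℝ) :
    lambertPower 2 q (Complex.exp (u * Complex.I))
      + lambertPower 2 q (Complex.exp (u * Complex.I))⁻¹ = 2 * cosSeries 0 1 q u := by
  have hn : ‖Complex.exp (u * Complex.I)‖ = 1 := Complex.norm_exp_ofReal_mul_I u
  have hn' : ‖(Complex.exp (u * Complex.I))⁻¹‖ = 1 := by rw [norm_inv, hn, inv_one]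
  have hb : ∀ x : ℂ, ‖x‖ = 1 → PolyBounded fun (_ : Unit) (d e : ℕ+) => (e : ℂ) * x ^ (d : ℕ) := by
    intro x hx
    refine ⟨1, 1, fun i d e => ?_⟩
    have : (1 : ℝ) ≤ d := mod_cast d.pos
    rw [norm_mul, norm_pow, hx, one_pow, mul_one, Complex.norm_natCast, one_mul, pow_one]
    exact le_mul_of_one_le_left (Nat.cast_nonneg _) this
  rw [lambertPower_two_eq_lambert h1 hn, lambertPower_two_eq_lambert h1 hn',
    ← lambert_add (hb _ hn) (hb _ hn') h1, cosSeries, ← lambert_const_mul]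
  congr 1
  funext d e
  rw [← Complex.exp_neg, ← Complex.exp_nat_mul, ← Complex.exp_nat_mul]
  simp only [pow_zero, pow_one, one_mul, Complex.ofReal_cos, Complex.cos, Complex.ofReal_mul,
    Complex.ofReal_natCast]
  ring_nf

lemma exp_mul_I_ne_one {u : ℝ} (hu : Real.sin (u / 2) ≠ 0) : Complex.exp (u * Complex.I) ≠ 1 := by
  intro h
  obtain ⟨n, hn⟩ := Complex.exp_eq_one_iff.1 h
  apply hu
  have h2 : (u : ℂ) = ((n * (2 * Real.pi) : ℝ) : ℂ) := by
    have := mul_right_cancel₀ Complex.I_ne_zero (hn.trans (by ring :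
      (n : ℂ) * (2 * Real.pi * Complex.I) = n * (2 * Real.pi) * Complex.I))
    rw [this]; push_cast; ring
  rw [Complex.ofReal_inj.1 h2, show (n : ℝ) * (2 * Real.pi) / 2 = n * Real.pi by ring]
  exact Real.sin_int_mul_pi n

/-- The addition theorem for `cotSeries`. -/
lemma cotSeries_addition {q : ℂ} (h0 : q ≠ 0) (h1 : ‖q‖ < 1) {u v : ℝ}
    (hu : Real.sin (u / 2) ≠ 0) (hv : Real.sin (v / 2) ≠ 0) (huv : Real.sin ((u + v) / 2) ≠ 0) :
    cotSeries q u * cotSeries q v - cotSeries q (u + v) * (cotSeries q u + cotSeries q v)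
      = 1 - 8 * cosSeries 0 1 q u - 8 * cosSeries 0 1 q v - 8 * cosSeries 0 1 q (u + v) := by
  have e : Complex.exp (u * Complex.I) * Complex.exp (v * Complex.I)
      = Complex.exp ((u + v : ℝ) * Complex.I) := by
    rw [← Complex.exp_add]; push_cast; ring_nf
  have h := kroneckerSeries_addition h0 h1 (Complex.norm_exp_ofReal_mul_I u)
    (Complex.norm_exp_ofReal_mul_I v) (exp_mul_I_ne_one hu) (exp_mul_I_ne_one hv)
    (by rw [e]; exact exp_mul_I_ne_one huv)
  rw [e, kroneckerSeries_exp h1 hu, kroneckerSeries_exp h1 hv, kroneckerSeries_exp h1 huv,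
    lambertPower_two_exp h1, lambertPower_two_exp h1, lambertPower_two_exp h1] at h
  linear_combination -4 * h + (cotSeries q u * cotSeries q v
    - cotSeries q (u + v) * (cotSeries q u + cotSeries q v)) * Complex.I_sq

lemma eventually_sin_half_ne_zero {u : ℝ} (hu : Real.sin (u / 2) ≠ 0) :
    ∀ᶠ x in 𝓝 u, Real.sin (x / 2) ≠ 0 :=
  ContinuousAt.eventually_ne (g := fun x => Real.sin (x / 2)) (by fun_prop) hu

/-- The simple pole at 0 has residue 2. It is needed to extract a differential equation from the
addition theorem as v tends to 0. -/
lemma tendsto_mul_cotSeries {q : ℂ} (h1 : ‖q‖ < 1) :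
    Filter.Tendsto (fun v : ℝ => (v : ℂ) * cotSeries q v) (𝓝[≠] 0) (𝓝 2) := by
  have hs : Filter.Tendsto (fun v : ℝ => v⁻¹ * Real.sin (v / 2)) (𝓝[≠] 0) (𝓝 (1 / 2)) := by
    have h := (((hasDerivAt_id (0 : ℝ)).div_const 2).sin).tendsto_slope_zero
    simpa using h
  have hc : Filter.Tendsto (fun v : ℝ => Real.cos (v / 2)) (𝓝[≠] 0) (𝓝 1) := by
    have : Filter.Tendsto (fun v : ℝ => Real.cos (v / 2)) (𝓝 0) (𝓝 (Real.cos (0 / 2))) :=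
      Continuous.tendsto (by fun_prop) 0
    simpa using this.mono_left nhdsWithin_le_nhds
  have h2 : Filter.Tendsto (fun v : ℝ => v * Real.cot (v / 2)) (𝓝[≠] 0) (𝓝 2) := by
    have := hc.div hs (by norm_num)
    norm_num at this
    refine this.congr fun v => ?_
    rw [Real.cot_eq_cos_div_sin, Pi.div_apply]
    simp only [div_eq_mul_inv, mul_inv, inv_inv]
    ring
  have h3 : Filter.Tendsto (fun v : ℝ => (v : ℂ) * (4 * sinSeries 0 0 q v)) (𝓝[≠] 0)
      (𝓝 (((0 : ℝ) : ℂ) * (4 * sinSeries 0 0 q 0))) := by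
    have hcont : ContinuousAt (fun v : ℝ => (v : ℂ) * (4 * sinSeries 0 0 q v)) 0 :=
      (Complex.continuous_ofReal.continuousAt).mul
        (continuousAt_const.mul (hasDerivAt_sinSeries 0 0 h1 0).continuousAt)
    exact hcont.tendsto.mono_left nhdsWithin_le_nhds
  have h4 := ((Complex.continuous_ofReal.tendsto 2).comp h2).add h3
  simp only [Complex.ofReal_zero, zero_mul, add_zero, Complex.ofReal_ofNat] at h4
  refine h4.congr fun v => ?_
  simp only [Function.comp, cotSeries]
  push_cast
  ring

/-- The Riccati equation of `cotSeries`, the limit `v → 0` of its addition theorem. -/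
lemma cotSeriesDeriv_eq {q : ℂ} (h0 : q ≠ 0) (h1 : ‖q‖ < 1) {u : ℝ} (hu : Real.sin (u / 2) ≠ 0) :
    cotSeriesDeriv q u
      = -(1 + cotSeries q u ^ 2) / 2 + 8 * cosSeries 0 1 q u + 4 * cosSeries 0 1 q 0 := by
  have hd := hasDerivAt_cotSeries h1 hu
  have hslope := hd.tendsto_slope_zero
  have hshift : ∀ {F : ℝ → ℂ}, ContinuousAt F u →
      Filter.Tendsto (fun v : ℝ => F (u + v)) (𝓝[≠] 0) (𝓝 (F u)) := by
    intro F hF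
    have h : Filter.Tendsto (fun v : ℝ => u + v) (𝓝 0) (𝓝 u) := by
      have hc : Continuous fun v : ℝ => u + v := by fun_prop
      simpa using hc.tendsto 0
    exact (hF.tendsto.comp h).mono_left nhdsWithin_le_nhds
  have hW : ∀ x, ContinuousAt (cosSeries 0 1 q) x := fun x =>
    (hasDerivAt_cosSeries 0 1 h1 x).continuousAt
  -- The left side of the addition theorem is regrouped as -C(v)(C(u+v) - C(u)) - C(u+v)C(u), with C
  -- = `cotSeries`; the first term is v C(v) times a difference quotient.
  have hl : Filter.Tendsto (fun v : ℝ => -((v : ℂ) * cotSeries q v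
      * (v⁻¹ • (cotSeries q (u + v) - cotSeries q u))) - cotSeries q (u + v) * cotSeries q u)
      (𝓝[≠] 0) (𝓝 (-(2 * cotSeriesDeriv q u) - cotSeries q u * cotSeries q u)) :=
    ((tendsto_mul_cotSeries h1).mul hslope).neg.sub ((hshift hd.continuousAt).mul_const _)
  have hr : Filter.Tendsto (fun v : ℝ => 1 - 8 * cosSeries 0 1 q u - 8 * cosSeries 0 1 q v
      - 8 * cosSeries 0 1 q (u + v)) (𝓝[≠] 0)
      (𝓝 (1 - 8 * cosSeries 0 1 q u - 8 * cosSeries 0 1 q 0 - 8 * cosSeries 0 1 q u)) :=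
    (tendsto_const_nhds.sub (((hW 0).tendsto.mono_left nhdsWithin_le_nhds).const_mul 8)).sub
      ((hshift (hW u)).const_mul 8)
  have hev : ∀ᶠ v : ℝ in 𝓝[≠] 0, Real.sin (v / 2) ≠ 0 ∧ Real.sin ((u + v) / 2) ≠ 0 ∧ v ≠ 0 := by
    have e1 : ∀ᶠ v : ℝ in 𝓝[≠] 0, Real.sin ((u + v) / 2) ≠ 0 := by
      refine nhdsWithin_le_nhds ?_
      exact ContinuousAt.eventually_ne (g := fun v => Real.sin ((u + v) / 2)) (by fun_prop)
        (by simpa using hu)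
    have e2 : ∀ᶠ v : ℝ in 𝓝[≠] 0, |v| < Real.pi := by
      refine nhdsWithin_le_nhds ?_
      exact (continuous_abs.continuousAt).eventually_lt_const (by simpa using Real.pi_pos)
    filter_upwards [e1, e2, self_mem_nhdsWithin] with v h1 h2 h3
    have h3 : v ≠ 0 := h3
    refine ⟨?_, h1, h3⟩
    have := abs_lt.1 h2
    rcases lt_or_gt_of_ne h3 with h | h
    · exact (Real.sin_neg_of_neg_of_neg_pi_lt (by linarith) (by linarith)).ne
    · exact (Real.sin_pos_of_pos_of_lt_pi (by linarith) (by linarith)).ne'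
  have := tendsto_nhds_unique_of_eventuallyEq hl hr (by
    filter_upwards [hev] with v ⟨hv, huv, hv0⟩
    have h := cotSeries_addition h0 h1 hu hv huv
    have hv0' : (v : ℂ) ≠ 0 := Complex.ofReal_ne_zero.2 hv0
    rw [← h, Complex.real_smul, Complex.ofReal_inv]
    field_simp
    ring)
  linear_combination -(1 / 2) * this

/-- Differentiating the Riccati equation, rather than the defining series, removes the constant
`cosSeries 0 1 q 0` and brings in `sinSeries 1 1`. -/
lemma hasDerivAt_cotSeriesDeriv {q : ℂ} (h0 : q ≠ 0) (h1 : ‖q‖ < 1) {u : ℝ}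
    (hu : Real.sin (u / 2) ≠ 0) :
    HasDerivAt (cotSeriesDeriv q)
      (-cotSeries q u * cotSeriesDeriv q u - 8 * sinSeries 1 1 q u) u := by
  have hd := hasDerivAt_cotSeries h1 hu
  have hW := hasDerivAt_cosSeries 0 1 h1 u
  have h := (((((hd.fun_pow 2).const_add 1).neg).div_const 2).add (hW.const_mul 8)).add_const
    (4 * cosSeries 0 1 q 0)
  refine (h.congr_of_eventuallyEq ?_).congr_deriv ?_
  · filter_upwards [eventually_sin_half_ne_zero hu] with x hx
    exact cotSeriesDeriv_eq h0 h1 hx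
  · simp only [zero_add]
    ring

/-- The u-derivative of the addition theorem. Its right side is, up to the factor πi, a sum of
τ-derivatives of `cotSeries`. -/
lemma cotSeries_addition_deriv {q : ℂ} (h0 : q ≠ 0) (h1 : ‖q‖ < 1) {u v : ℝ}
    (hu : Real.sin (u / 2) ≠ 0) (hv : Real.sin (v / 2) ≠ 0) (huv : Real.sin ((u + v) / 2) ≠ 0) :
    cotSeriesDeriv q u * cotSeries q v - cotSeriesDeriv q (u + v) * (cotSeries q u + cotSeries q v)
      - cotSeries q (u + v) * cotSeriesDeriv q u
      = 8 * sinSeries 1 1 q u + 8 * sinSeries 1 1 q (u + v) := by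
  have hd := hasDerivAt_cotSeries h1 hu
  have hd2 := (hasDerivAt_cotSeries h1 huv).comp_add_const u v
  have hW := hasDerivAt_cosSeries 0 1 h1 u
  have hW2 := (hasDerivAt_cosSeries 0 1 h1 (u + v)).comp_add_const u v
  have hl := (hd.mul_const (cotSeries q v)).sub (hd2.mul (hd.add_const (cotSeries q v)))
  have hr := ((((hW.const_mul 8).const_sub 1).sub_const (8 * cosSeries 0 1 q v))).sub
    (hW2.const_mul 8)
  have hev : ∀ᶠ x in 𝓝 u, Real.sin ((x + v) / 2) ≠ 0 :=
    ContinuousAt.eventually_ne (g := fun x => Real.sin ((x + v) / 2)) (by fun_prop) huv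
  have h := hl.unique (hr.congr_of_eventuallyEq (by
    filter_upwards [eventually_sin_half_ne_zero hu, hev] with x hx hx2
    exact cotSeries_addition h0 h1 hx hv hx2))
  simp only [zero_add] at h
  linear_combination h

/-- The mixed derivative in u and v leaves only the term at u + v. It yields `cosSeries 2 1`, the
series in the τ-derivative of `cotSeriesDeriv`. -/
lemma cotSeries_addition_deriv_deriv {q : ℂ} (h0 : q ≠ 0) (h1 : ‖q‖ < 1) {u v : ℝ}
    (hu : Real.sin (u / 2) ≠ 0) (hv : Real.sin (v / 2) ≠ 0) (huv : Real.sin ((u + v) / 2) ≠ 0) :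
    cotSeriesDeriv q u * cotSeriesDeriv q v
      - (-cotSeries q (u + v) * cotSeriesDeriv q (u + v) - 8 * sinSeries 1 1 q (u + v))
        * (cotSeries q u + cotSeries q v)
      - cotSeriesDeriv q (u + v) * (cotSeriesDeriv q u + cotSeriesDeriv q v)
      = 8 * cosSeries 2 1 q (u + v) := by
  have hd := hasDerivAt_cotSeries h1 hv
  have hd2 := (hasDerivAt_cotSeries h1 huv).comp_const_add u v
  have hd3 := (hasDerivAt_cotSeriesDeriv h0 h1 huv).comp_const_add u v
  have hW2 := (hasDerivAt_sinSeries 1 1 h1 (u + v)).comp_const_add u v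
  have hl := ((hd.const_mul (cotSeriesDeriv q u)).sub (hd3.mul (hd.const_add (cotSeries q u)))).sub
    (hd2.mul_const (cotSeriesDeriv q u))
  have hr := (hW2.const_mul 8).const_add (8 * sinSeries 1 1 q u)
  have hev : ∀ᶠ x in 𝓝 v, Real.sin ((u + x) / 2) ≠ 0 :=
    ContinuousAt.eventually_ne (g := fun x => Real.sin ((u + x) / 2)) (by fun_prop) huv
  have h := hl.unique (hr.congr_of_eventuallyEq (by
    filter_upwards [eventually_sin_half_ne_zero hv, hev] with x hx hx2
    exact cotSeries_addition_deriv h0 h1 hu hx hx2))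
  linear_combination h

lemma cotSeries_neg (q : ℂ) (u : ℝ) : cotSeries q (-u) = -cotSeries q u := by
  rw [cotSeries, cotSeries, sinSeries_neg, neg_div 2 u, Real.cot_eq_cos_div_sin,
    Real.cot_eq_cos_div_sin, Real.cos_neg, Real.sin_neg]
  push_cast
  ring

lemma cot_half_add_two_pi (u : ℝ) : Real.cot ((u + 2 * Real.pi) / 2) = Real.cot (u / 2) := by
  rw [show (u + 2 * Real.pi) / 2 = u / 2 + Real.pi by ring, Real.cot_eq_cos_div_sin,
    Real.cot_eq_cos_div_sin, Real.cos_add_pi, Real.sin_add_pi, neg_div_neg_eq]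

lemma cotSeries_add_two_pi (q : ℂ) (u : ℝ) : cotSeries q (u + 2 * Real.pi) = cotSeries q u := by
  rw [cotSeries, cotSeries, sinSeries_add_two_pi, cot_half_add_two_pi]

lemma cotSeriesDeriv_neg (q : ℂ) (u : ℝ) : cotSeriesDeriv q (-u) = cotSeriesDeriv q u := by
  rw [cotSeriesDeriv, cotSeriesDeriv, cosSeries_neg, neg_div 2 u, Real.cot_eq_cos_div_sin,
    Real.cot_eq_cos_div_sin, Real.cos_neg, Real.sin_neg]
  push_cast
  ring

lemma cotSeriesDeriv_add_two_pi (q : ℂ) (u : ℝ) :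
    cotSeriesDeriv q (u + 2 * Real.pi) = cotSeriesDeriv q u := by
  rw [cotSeriesDeriv, cotSeriesDeriv, cosSeries_add_two_pi, cot_half_add_two_pi]

/-! ### The frozen series in terms of `cotSeries` -/

lemma lambert_eq_tsum_divisors {g : ℕ → ℂ} {C : ℝ} (hg : ∀ d, ‖g d‖ ≤ C) {q : ℂ} (h1 : ‖q‖ < 1) :
    lambert (fun d _ => g d) q
      = ∑' n : ℕ, (∑ d ∈ (n + 1).divisors, g d) * q ^ (n + 1) := by
  have hb : PolyBounded fun (_ : Unit) (d _ : ℕ+) => g d :=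
    ⟨C, 0, fun i d e => by simpa using hg d⟩
  have hs := (sigmaAntidiagonalEquivProd.hasSum_iff.2 (hb.summable () h1).hasSum).sigma
    (fun n => hasSum_fintype _)
  rw [← tsum_pnat_eq_tsum_succ (f := fun n => (∑ d ∈ n.divisors, g d) * q ^ n), lambert,
    ← hs.tsum_eq]
  refine tsum_congr fun n => ?_
  rw [Finset.sum_mul, ← Nat.sum_divisorsAntidiagonal (fun d _ => g d * q ^ (n : ℕ)),
    ← Finset.sum_coe_sort ((n : ℕ).divisorsAntidiagonal)]
  refine Finset.sum_congr rfl fun x _ => ?_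
  exact congrArg (fun m => g x.1.1 * q ^ m) (divisorsAntidiagonalFactors_eq x)

/-- The indicator of `i` minus that of `j` modulo `5`. -/
def residueDiff (i j d : ℕ) : ℂ :=
  (if d ≡ i [MOD 5] then 1 else 0) - (if d ≡ j [MOD 5] then 1 else 0)

lemma norm_residueDiff_le (i j d : ℕ) : ‖residueDiff i j d‖ ≤ 2 := by
  refine (norm_sub_le _ _).trans ?_
  have : ∀ p : Prop, [Decidable p] → ‖(if p then 1 else 0 : ℂ)‖ ≤ 1 := by
    intro p _; split_ifs <;> simp
  linarith [this (d ≡ i [MOD 5]), this (d ≡ j [MOD 5])]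

lemma divSeries_eq_lambert (i j : ℕ) {τ : ℂ} (hτ : 0 < τ.im) :
    divSeries i j τ = lambert (fun d _ => residueDiff i j d) (nome τ) := by
  rw [lambert_eq_tsum_divisors (norm_residueDiff_le i j) (norm_nome_lt_one hτ), divSeries]
  refine tsum_congr fun n => ?_
  simp only [residueDiff, divCount, Finset.sum_sub_distrib, Finset.sum_boole]

/-- Since u is a multiple of 2π/5, sin(du) depends only on d modulo 5 and is odd: the values at the
residues 0, ..., 4 are 0, s, t, -t, -s. -/
lemma sinSeries_fifth (k : ℕ) {s t : ℝ} {u : ℝ} (hu : u = k * (2 * Real.pi / 5))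
    (hs : s = Real.sin u) (ht : t = Real.sin (2 * u)) {τ : ℂ} (hτ : 0 < τ.im) :
    sinSeries 0 0 (nome τ) u = s * divSeries 1 4 τ + t * divSeries 2 3 τ := by
  have hb : ∀ i j, PolyBounded fun (_ : Unit) (d _ : ℕ+) => residueDiff i j d := fun i j =>
    ⟨2, 0, fun _ d e => by simpa using norm_residueDiff_le i j d⟩
  have hb' : ∀ (c : ℝ) (i j), PolyBounded fun (_ : Unit) (d _ : ℕ+) => c * residueDiff i j d :=
    fun c i j => ⟨|c| * 2, 0, fun _ d e => by
      rw [norm_mul, Complex.norm_real, Real.norm_eq_abs, pow_zero, mul_one]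
      exact mul_le_mul_of_nonneg_left (norm_residueDiff_le i j d) (abs_nonneg _)⟩
  rw [divSeries_eq_lambert 1 4 hτ, divSeries_eq_lambert 2 3 hτ, ← lambert_const_mul,
    ← lambert_const_mul, ← lambert_add (hb' s 1 4) (hb' t 2 3) (norm_nome_lt_one hτ), sinSeries]
  congr 1
  funext d e
  have per : ∀ (a b : ℝ) (n : ℕ), a = b + n * (2 * Real.pi) → Real.sin a = Real.sin b := by
    rintro a b n rfl; exact Real.sin_add_nat_mul_two_pi b n
  have hd := Nat.div_add_mod (d : ℕ) 5
  set m := (d : ℕ) / 5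
  set r := (d : ℕ) % 5 with hr
  have hr5 : r < 5 := Nat.mod_lt _ (by norm_num)
  have hd' : (d : ℝ) = 5 * m + r := by exact_mod_cast hd.symm
  have hdr : Real.sin (d * u) = Real.sin (r * u) := by
    refine per _ _ (m * k) ?_
    rw [hd', hu]; push_cast; ring
  have s3 : Real.sin (3 * u) = -t := by
    rw [ht, ← Real.sin_neg]
    refine per _ _ k ?_
    rw [hu]; ring
  have s4 : Real.sin (4 * u) = -s := by
    rw [hs, ← Real.sin_neg]
    refine per _ _ k ?_
    rw [hu]; ring
  simp only [pow_zero, one_mul, residueDiff, Nat.ModEq, ← hr, hdr]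
  interval_cases r
  · simp
  · simp [hs]
  · simp [ht]
  · simp [s3]
  · simp [s4]

lemma Q_eq_cotSeries {τ : ℂ} (hτ : 0 < τ.im) : Q τ = cotSeries (nome τ) (2 * Real.pi / 5) := by
  rw [Q, cotSeries, sinSeries_fifth 1 (by push_cast; ring) rfl rfl hτ,
    show 2 * Real.pi / 5 / 2 = Real.pi / 5 by ring,
    show 2 * (2 * Real.pi / 5) = 4 * Real.pi / 5 by ring]
  ring

lemma P_eq_cotSeries {τ : ℂ} (hτ : 0 < τ.im) : P τ = cotSeries (nome τ) (4 * Real.pi / 5) := by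
  have h : -Real.sin (2 * Real.pi / 5) = Real.sin (2 * (4 * Real.pi / 5)) := by
    rw [show 2 * (4 * Real.pi / 5) = -(2 * Real.pi / 5) + 2 * Real.pi by ring,
      Real.sin_add_two_pi, Real.sin_neg]
  rw [P, cotSeries, sinSeries_fifth 2 (by push_cast; ring) rfl h hτ,
    show 4 * Real.pi / 5 / 2 = 2 * Real.pi / 5 by ring]
  push_cast
  ring

/-! ### The product `f` as the exponential of a Lambert series -/

lemma cos_two_pi_div_five : Real.cos (2 * Real.pi / 5) = (√5 - 1) / 4 := by
  have h5 : √5 ^ 2 = 5 := Real.sq_sqrt (by norm_num)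
  rw [show 2 * Real.pi / 5 = 2 * (Real.pi / 5) by ring, Real.cos_two_mul, Real.cos_pi_div_five]
  linear_combination h5 / 8

lemma cos_four_pi_div_five : Real.cos (4 * Real.pi / 5) = -(1 + √5) / 4 := by
  rw [show 4 * Real.pi / 5 = Real.pi - Real.pi / 5 by ring, Real.cos_pi_sub, Real.cos_pi_div_five]
  ring

/-- The quadratic factors as (1 - e^{iθ}x)(1 - e^{-iθ}x), and a is the sum of the Taylor series of
the two negated logarithms. -/
lemma exp_neg_tsum_cos {x : ℂ} (hx : ‖x‖ < 1) (θ : ℝ) :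
    ∃ a : ℂ, HasSum (fun n : ℕ => ((2 * Real.cos ((n + 1 : ℕ) * θ) / (n + 1 : ℕ) : ℝ) : ℂ)
        * x ^ (n + 1)) a ∧
      1 - 2 * (Real.cos θ : ℂ) * x + x ^ 2 = Complex.exp (-a) := by
  have hn : ∀ t : ℝ, ‖Complex.exp (t * Complex.I) * x‖ < 1 := fun t => by
    rwa [norm_mul, Complex.norm_exp_ofReal_mul_I, one_mul]
  have hne : ∀ t : ℝ, 1 - Complex.exp (t * Complex.I) * x ≠ 0 := fun t h => by
    have := hn t
    rw [← sub_eq_zero.1 h, norm_one] at this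
    exact this.false
  have h1 := Complex.hasSum_taylorSeries_neg_log' (hn θ)
  have h2 := Complex.hasSum_taylorSeries_neg_log' (hn (-θ))
  refine ⟨-Complex.log (1 - Complex.exp (θ * Complex.I) * x)
    + -Complex.log (1 - Complex.exp ((-θ : ℝ) * Complex.I) * x), ?_, ?_⟩
  · refine (congrArg (HasSum · _) (funext fun n => ?_)).mpr (h1.add h2)
    rw [mul_pow, mul_pow, ← Complex.exp_nat_mul, ← Complex.exp_nat_mul]
    simp only [Complex.ofReal_div, Complex.ofReal_mul, Complex.ofReal_cos, Complex.cos,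
      Complex.ofReal_natCast, Complex.ofReal_neg, Complex.ofReal_ofNat]
    push_cast
    ring_nf
  · rw [neg_add, neg_neg, neg_neg, Complex.exp_add, Complex.exp_log (hne _), Complex.exp_log (hne _)]
    have e : Complex.exp (θ * Complex.I) * Complex.exp ((-θ : ℝ) * Complex.I) = 1 := by
      rw [← Complex.exp_add]; simp
    rw [Complex.ofReal_cos, Complex.cos, Complex.ofReal_neg] at *
    linear_combination (-x ^ 2) * e

/-- Coefficients of the double series of `log (f / α) / 5`. -/
def logCoeff (d _e : ℕ+) : ℂ :=
  ((2 * Real.cos (d * (2 * Real.pi / 5)) / d : ℝ) : ℂ)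
    - ((2 * Real.cos (d * (4 * Real.pi / 5)) / d : ℝ) : ℂ)

lemma polyBounded_logCoeff : PolyBounded fun _ : Unit => logCoeff := by
  have h : ∀ (d : ℕ+) (t : ℝ), ‖((2 * Real.cos t / d : ℝ) : ℂ)‖ ≤ 2 := by
    intro d t
    have hd : (1 : ℝ) ≤ d := mod_cast d.pos
    have hd0 : (0 : ℝ) < d := by linarith
    rw [Complex.norm_real, Real.norm_eq_abs, abs_div, abs_mul, abs_two, abs_of_pos hd0,
      div_le_iff₀ hd0]
    nlinarith [Real.abs_cos_le_one t]
  refine ⟨4, 0, fun i d e => (norm_sub_le _ _).trans ?_⟩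
  rw [pow_zero, mul_one]
  linarith [h d (d * (2 * Real.pi / 5)), h d (d * (4 * Real.pi / 5))]

lemma f_eq_exp {τ : ℂ} (hτ : 0 < τ.im) :
    f τ = α * Complex.exp (5 * lambert logCoeff (nome τ)) := by
  have h1 := norm_nome_lt_one hτ
  set q := nome τ with hq
  rw [f, α]
  congr 1
  rw [← hq]
  have hx : ∀ n : ℕ, ‖q ^ (n + 1)‖ < 1 := fun n => by
    rw [norm_pow]; exact pow_lt_one₀ (norm_nonneg _) h1 n.succ_ne_zero
  choose a ha ha' using fun n => exp_neg_tsum_cos (hx n) (2 * Real.pi / 5)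
  choose b hb hb' using fun n => exp_neg_tsum_cos (hx n) (4 * Real.pi / 5)
  have hsum := (polyBounded_logCoeff.summable () h1).hasSum
  have hfib : HasSum (fun e : ℕ+ => a (e - 1 : ℕ) - b (e - 1 : ℕ)) (lambert logCoeff q) := by
    -- The fibre of the double series over e is the logarithm of the factor with n = e; `a` and `b`
    -- are indexed from 0, whence e - 1.
    refine ((Equiv.prodComm ℕ+ ℕ+).hasSum_iff.2 hsum).prod_fiberwise fun e => ?_
    have h := (ha (e - 1 : ℕ)).sub (hb (e - 1 : ℕ))
    rw [← Equiv.pnatEquivNat.hasSum_iff] at h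
    refine (congrArg (HasSum · _) (funext fun d => ?_)).mpr h
    have hd : Equiv.pnatEquivNat d + 1 = (d : ℕ) := PNat.natPred_add_one d
    have he : (e : ℕ) - 1 + 1 = e := PNat.natPred_add_one e
    simp only [Function.comp, Equiv.prodComm_apply, Prod.swap, logCoeff, hd, he]
    rw [← pow_mul, mul_comm (e : ℕ)]
    ring
  have hfib2 : HasSum (fun n : ℕ => 5 * (a n - b n)) (5 * lambert logCoeff q) := by
    refine HasSum.mul_left 5 ?_
    rw [← Equiv.pnatEquivNat.hasSum_iff]
    exact hfib
  rw [← hfib2.cexp.tprod_eq]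
  refine tprod_congr fun n => ?_
  have e1 : 1 + (1 + (Real.sqrt 5 : ℂ)) / 2 * q ^ (n + 1) + q ^ (2 * (n + 1))
      = Complex.exp (-b n) := by
    rw [← hb' n, cos_four_pi_div_five]; push_cast; ring
  have e2 : 1 + (1 - (Real.sqrt 5 : ℂ)) / 2 * q ^ (n + 1) + q ^ (2 * (n + 1))
      = Complex.exp (-a n) := by
    rw [← ha' n, cos_two_pi_div_five]; push_cast; ring
  rw [e1, e2, ← div_pow, ← Complex.exp_sub, ← Complex.exp_nat_mul, Function.comp]
  congr 1
  push_cast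
  ring

/-! ### Behaviour at the cusp -/

lemma tendsto_lambert_zero {w : ℕ+ → ℕ+ → ℂ} (hw : PolyBounded fun _ : Unit => w) :
    Filter.Tendsto (lambert w) (𝓝 0) (𝓝 0) := by
  obtain ⟨m, hm, hb⟩ := hw.exists_norm_term_le (r := 1 / 2) (by norm_num) (by norm_num)
  have h := tendsto_tsum_of_dominated_convergence (𝓕 := 𝓝 (0 : ℂ))
    (f := fun q (p : ℕ+ × ℕ+) => w p.1 p.2 * q ^ (p.1 * p.2 : ℕ)) (g := fun _ => (0 : ℂ)) hm
    (fun p => by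
      have hc : Continuous fun q : ℂ => w p.1 p.2 * q ^ (p.1 * p.2 : ℕ) := by fun_prop
      have := hc.tendsto 0
      rwa [zero_pow (mul_pos p.1.pos p.2.pos).ne', mul_zero] at this)
    (by
      have : ∀ᶠ q : ℂ in 𝓝 0, ‖q‖ < 1 / 2 :=
        continuous_norm.continuousAt.eventually_lt_const (by norm_num)
      filter_upwards [this] with q hq p using hb () q hq.le p)
  rwa [tsum_zero] at h

/-- After division by q only the pair with de = 1 keeps the exponent 0. This isolates the first
Fourier coefficient. -/
lemma tendsto_lambert_div {w : ℕ+ → ℕ+ → ℂ} (hw : PolyBounded fun _ : Unit => w) :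
    Filter.Tendsto (fun q => lambert w q / q) (𝓝[≠] 0) (𝓝 (w 1 1)) := by
  obtain ⟨m, hm, hb⟩ := hw.exists_norm_term_le (r := 1 / 2) (by norm_num) (by norm_num)
  have hpos : ∀ p : ℕ+ × ℕ+, (p.1 * p.2 : ℕ) - 1 + 1 = (p.1 * p.2 : ℕ) := fun p =>
    Nat.sub_add_cancel (mul_pos p.1.pos p.2.pos)
  have h := tendsto_tsum_of_dominated_convergence (𝓕 := 𝓝 (0 : ℂ))
    (f := fun q (p : ℕ+ × ℕ+) => w p.1 p.2 * q ^ ((p.1 * p.2 : ℕ) - 1))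
    (g := fun p => w p.1 p.2 * 0 ^ ((p.1 * p.2 : ℕ) - 1)) (hm.mul_left 2)
    (fun p => by
      have hc : Continuous fun q : ℂ => w p.1 p.2 * q ^ ((p.1 * p.2 : ℕ) - 1) := by fun_prop
      exact hc.tendsto 0)
    (by
      have : ∀ᶠ q : ℂ in 𝓝 0, ‖q‖ < 1 / 2 :=
        continuous_norm.continuousAt.eventually_lt_const (by norm_num)
      filter_upwards [this] with q hq p
      -- Comparison with the radius 1/2: lowering the exponent by one costs the factor 2 in the
      -- majorant.
      have h2 := hb () (1 / 2) (by simp) p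
      rw [← hpos p, pow_succ, ← mul_assoc, norm_mul] at h2
      have h3 : ‖w p.1 p.2 * q ^ ((p.1 * p.2 : ℕ) - 1)‖
          ≤ ‖w p.1 p.2 * (1 / 2) ^ ((p.1 * p.2 : ℕ) - 1)‖ := by
        rw [norm_mul, norm_mul, norm_pow, norm_pow]
        gcongr
        simpa using hq.le
      have h4 : ‖(1 / 2 : ℂ)‖ = 1 / 2 := by norm_num
      rw [h4] at h2
      linarith)
  rw [tsum_eq_single ((1, 1) : ℕ+ × ℕ+)] at h
  · have h' : Filter.Tendsto _ (𝓝[≠] (0 : ℂ)) _ := h.mono_left nhdsWithin_le_nhds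
    simp only [PNat.one_coe, mul_one, Nat.sub_self, pow_zero] at h'
    refine h'.congr' ?_
    filter_upwards [self_mem_nhdsWithin] with q hq
    rw [eq_div_iff hq, lambert, ← tsum_mul_right]
    refine tsum_congr fun p => ?_
    rw [mul_assoc, ← pow_succ, hpos]
  · rintro ⟨d, e⟩ hp
    have h2 : ((d : ℕ) * e) ≠ 1 := by
      intro h
      apply hp
      exact Prod.ext (PNat.coe_inj.1 (Nat.eq_one_of_mul_eq_one_right h))
        (PNat.coe_inj.1 (Nat.eq_one_of_mul_eq_one_left h))
    have h3 := mul_pos d.pos e.pos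
    rw [zero_pow (by simp only; omega), mul_zero]

lemma tendsto_nome_atImInfty :
    Filter.Tendsto (fun t : ℝ => nome (t * Complex.I)) Filter.atTop (𝓝[≠] 0) := by
  refine tendsto_nhdsWithin_iff.2 ⟨?_, Filter.Eventually.of_forall fun t => nome_ne_zero _⟩
  refine tendsto_zero_iff_norm_tendsto_zero.2 ?_
  have h : ∀ t : ℝ, ‖nome (t * Complex.I)‖ = Real.exp (-(2 * Real.pi * t)) := fun t => by
    rw [norm_nome]; simp
  simp_rw [h]
  refine Real.tendsto_exp_atBot.comp ?_
  exact Filter.tendsto_neg_atTop_atBot.comp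
    (Filter.tendsto_id.const_mul_atTop (by positivity))

/-! ### Differential equations in `τ` -/

/-- The quasi-modular form of weight two: the derivative of `cotSeries` at `2π/5`. -/
def A (τ : ℂ) : ℂ := cotSeriesDeriv (nome τ) (2 * Real.pi / 5)

/-- The companion `P + 3Q` of the form `S`. -/
def V (τ : ℂ) : ℂ := P τ + 3 * Q τ

lemma sin_fifth_half_ne_zero {u : ℝ} (k : ℕ) (hk : k = 1 ∨ k = 2 ∨ k = 4) (hu : u = k * (2 * Real.pi / 5)) :
    Real.sin (u / 2) ≠ 0 := by
  have hpi := Real.pi_pos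
  refine (Real.sin_pos_of_pos_of_lt_pi ?_ ?_).ne' <;> subst hu <;>
    rcases hk with rfl | rfl | rfl <;> push_cast <;> linarith


/-- The relations between the values of `cotSeries` and its derivatives at the fifths of a period. -/
lemma fifth_relations {τ : ℂ} (hτ : 0 < τ.im) :
    8 * (cosSeries 0 1 (nome τ) (4 * Real.pi / 5) - cosSeries 0 1 (nome τ) (2 * Real.pi / 5))
        = Q τ ^ 2 - 4 * P τ * Q τ - P τ ^ 2 ∧
    4 * sinSeries 1 1 (nome τ) (2 * Real.pi / 5) = -(A τ * Q τ) / 2 - V τ ^ 2 * S τ / 8 ∧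
    4 * sinSeries 1 1 (nome τ) (4 * Real.pi / 5)
        = -(A τ * P τ) / 2 - V τ * S τ * (Q τ - P τ) / 8 ∧
    4 * cosSeries 2 1 (nome τ) (2 * Real.pi / 5)
        = -A τ ^ 2 / 2 + V τ ^ 2 * S τ ^ 2 / 8 + P τ * V τ ^ 2 * S τ / 4 := by
  have h0 := nome_ne_zero τ
  have h1 := norm_nome_lt_one hτ
  have n1 : Real.sin (2 * Real.pi / 5 / 2) ≠ 0 :=
    sin_fifth_half_ne_zero 1 (by norm_num) (by push_cast; ring)
  have n2 : Real.sin (4 * Real.pi / 5 / 2) ≠ 0 :=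
    sin_fifth_half_ne_zero 2 (by norm_num) (by push_cast; ring)
  have e11 : 2 * Real.pi / 5 + 2 * Real.pi / 5 = 4 * Real.pi / 5 := by ring
  -- Doubling 4π/5 leads back to 2π/5 up to sign and period, which closes the system.
  have e22 : 4 * Real.pi / 5 + 4 * Real.pi / 5 = -(2 * Real.pi / 5) + 2 * Real.pi := by ring
  have n22 : Real.sin ((4 * Real.pi / 5 + 4 * Real.pi / 5) / 2) ≠ 0 :=
    sin_fifth_half_ne_zero 4 (by norm_num) (by push_cast; ring)
  have k11 := cotSeries_addition h0 h1 n1 n1 (by rwa [e11])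
  have k22 := cotSeries_addition h0 h1 n2 n2 n22
  have d11 := cotSeries_addition_deriv h0 h1 n1 n1 (by rwa [e11])
  have d22 := cotSeries_addition_deriv h0 h1 n2 n2 n22
  have t22 := cotSeries_addition_deriv_deriv h0 h1 n2 n2 n22
  have r1 := cotSeriesDeriv_eq h0 h1 n1
  have r2 := cotSeriesDeriv_eq h0 h1 n2
  rw [e11] at k11 d11
  rw [e22] at k22 d22 t22
  simp only [cotSeries_add_two_pi, cotSeriesDeriv_add_two_pi, sinSeries_add_two_pi,
    cosSeries_add_two_pi, cotSeries_neg, cotSeriesDeriv_neg, sinSeries_neg, cosSeries_neg,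
    ← Q_eq_cotSeries hτ, ← P_eq_cotSeries hτ, ← A.eq_1] at k11 k22 d11 d22 t22 r1 r2
  -- The Riccati equations give the difference of the two derivatives as (Q² - P²)/2 + (Q² - 4PQ -
  -- P²), and this factors as (P + 3Q)(Q - 3P)/2. The forms `V` and `S` enter here.
  have hB : cotSeriesDeriv (nome τ) (4 * Real.pi / 5) = A τ + V τ * S τ / 2 := by
    simp only [V, S]
    linear_combination r2 - r1 - (k11 - k22)
  rw [hB] at d11 d22 t22
  -- The right sides of `d11` and `d22` are 8 times the sum and the difference of the two values of
  -- `sinSeries 1 1`, so the pair can be solved for both.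
  have hs1 : 4 * sinSeries 1 1 (nome τ) (2 * Real.pi / 5)
      = -(A τ * Q τ) / 2 - V τ ^ 2 * S τ / 8 := by
    simp only [V, S] at *
    linear_combination (1 / 4) * (d22 - d11)
  refine ⟨?_, hs1, ?_, ?_⟩
  · linear_combination k22 - k11
  · simp only [V, S] at *
    linear_combination -(1 / 4) * (d22 + d11)
  · simp only [V, S] at *
    linear_combination -(1 / 2) * t22 - 2 * P τ * hs1

lemma hasDerivAt_Q {τ : ℂ} (hτ : 0 < τ.im) :
    HasDerivAt Q (2 * Real.pi * Complex.I * (-(A τ * Q τ) / 2 - V τ ^ 2 * S τ / 8)) τ := by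
  have h := ((hasDerivAt_sinSeries_nome 0 0 hτ (2 * Real.pi / 5)).const_mul 4).const_add
    (Real.cot (2 * Real.pi / 5 / 2) : ℂ)
  refine (h.congr_of_eventuallyEq ?_).congr_deriv ?_
  · filter_upwards [(isOpen_lt continuous_const Complex.continuous_im).mem_nhds hτ] with z hz
    exact Q_eq_cotSeries hz
  · linear_combination 2 * Real.pi * Complex.I * (fifth_relations hτ).2.1

lemma hasDerivAt_P {τ : ℂ} (hτ : 0 < τ.im) :
    HasDerivAt P (2 * Real.pi * Complex.I *
      (-(A τ * P τ) / 2 - V τ * S τ * (Q τ - P τ) / 8)) τ := by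
  have h := ((hasDerivAt_sinSeries_nome 0 0 hτ (4 * Real.pi / 5)).const_mul 4).const_add
    (Real.cot (4 * Real.pi / 5 / 2) : ℂ)
  refine (h.congr_of_eventuallyEq ?_).congr_deriv ?_
  · filter_upwards [(isOpen_lt continuous_const Complex.continuous_im).mem_nhds hτ] with z hz
    exact P_eq_cotSeries hz
  · linear_combination 2 * Real.pi * Complex.I * (fifth_relations hτ).2.2.1

lemma hasDerivAt_A {τ : ℂ} (hτ : 0 < τ.im) :
    HasDerivAt A (2 * Real.pi * Complex.I *
      (-A τ ^ 2 / 2 + V τ ^ 2 * S τ ^ 2 / 8 + P τ * V τ ^ 2 * S τ / 4)) τ := by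
  have h := ((hasDerivAt_cosSeries_nome 1 0 hτ (2 * Real.pi / 5)).const_mul 4).const_add
    (-(1 + (Real.cot (2 * Real.pi / 5 / 2) : ℂ) ^ 2) / 2)
  refine h.congr_deriv ?_
  linear_combination 2 * Real.pi * Complex.I * (fifth_relations hτ).2.2.2

/-- The logarithmic derivative of `S`, up to the factor `2πi`. -/
def logDerivS (τ : ℂ) : ℂ := -(A τ + P τ * V τ) / 2

lemma hasDerivAt_S {τ : ℂ} (hτ : 0 < τ.im) :
    HasDerivAt S (2 * Real.pi * Complex.I * logDerivS τ * S τ) τ := by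
  refine (((hasDerivAt_P hτ).const_mul (-3)).add (hasDerivAt_Q hτ)).congr_deriv ?_
  simp only [logDerivS, V, S]
  ring

lemma hasDerivAt_V {τ : ℂ} (hτ : 0 < τ.im) :
    HasDerivAt V (2 * Real.pi * Complex.I *
      (-(A τ + S τ * (5 * Q τ + P τ) / 2) / 2) * V τ) τ := by
  refine ((hasDerivAt_P hτ).add ((hasDerivAt_Q hτ).const_mul 3)).congr_deriv ?_
  simp only [V, S]
  ring

/-- The quasi-modular `A` enters only through the square of `logDerivS`. That square cancels against
the derivative of 1/S when logDerivS/S is differentiated in w. -/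
lemma hasDerivAt_logDerivS {τ : ℂ} (hτ : 0 < τ.im) :
    HasDerivAt logDerivS (2 * Real.pi * Complex.I * (logDerivS τ ^ 2
      - 5 / 8 * P τ * V τ * (P τ ^ 2 + 4 * P τ * Q τ - Q τ ^ 2))) τ := by
  refine (((hasDerivAt_A hτ).add ((hasDerivAt_P hτ).mul (hasDerivAt_V hτ))).neg.div_const
    2).congr_deriv ?_
  simp only [logDerivS, V, S]
  ring

/-- The factor de from the τ-derivative cancels the 1/d in `logCoeff`, leaving a difference of
values of `cosSeries 0 1`, which the addition theorem makes quadratic in `P` and `Q`. -/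
lemma hasDerivAt_f {τ : ℂ} (hτ : 0 < τ.im) :
    HasDerivAt f (2 * Real.pi * Complex.I *
      (-(5 / 4) * (Q τ ^ 2 - 4 * P τ * Q τ - P τ ^ 2)) * f τ) τ := by
  have h := ((((hasDerivAt_lambert_nome polyBounded_logCoeff hτ).const_mul 5).cexp).const_mul α)
  refine (h.congr_of_eventuallyEq ?_).congr_deriv ?_
  · filter_upwards [(isOpen_lt continuous_const Complex.continuous_im).mem_nhds hτ] with z hz
    exact f_eq_exp hz
  · have hw : lambert (fun d e => d * e * logCoeff d e) (nome τ)
        = 2 * cosSeries 0 1 (nome τ) (2 * Real.pi / 5)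
          + -2 * cosSeries 0 1 (nome τ) (4 * Real.pi / 5) := by
      have hb : ∀ (c u : ℝ), PolyBounded fun (_ : Unit) (d e : ℕ+) => (c : ℂ) *
          (((d : ℝ) ^ 0 * (e : ℝ) ^ 1 * Real.cos (d * u) : ℝ) : ℂ) := by
        intro c u
        obtain ⟨C, k, h⟩ := polyBounded_cos 0 1
        refine ⟨|c| * C, k, fun _ d e => ?_⟩
        rw [norm_mul, Complex.norm_real, Real.norm_eq_abs, mul_assoc |c|]
        exact mul_le_mul_of_nonneg_left (h u d e) (abs_nonneg c)
      have := lambert_add (hb 2 (2 * Real.pi / 5)) (hb (-2) (4 * Real.pi / 5))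
        (norm_nome_lt_one hτ)
      rw [lambert_const_mul, lambert_const_mul] at this
      push_cast at this
      rw [cosSeries, cosSeries]
      push_cast
      rw [← this]
      congr 1
      funext d e
      have hd : (d : ℂ) ≠ 0 := by exact_mod_cast d.ne_zero
      rw [logCoeff]
      push_cast
      field_simp
      ring
    rw [f_eq_exp hτ, hw]
    linear_combination (-(5 / 4) * 2 * Real.pi * Complex.I * α
      * Complex.exp (5 * lambert logCoeff (nome τ))) * (fifth_relations hτ).1

/-! ### Values at the cusp -/

lemma α_ne_zero : α ≠ 0 := by
  have h : (0 : ℝ) < (11 + 5 * √5) / 2 := by positivity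
  have h2 : α = (((11 + 5 * √5) / 2 : ℝ) : ℂ) := by rw [α]; push_cast; ring
  rw [h2, Complex.ofReal_ne_zero]
  exact h.ne'

lemma sqrt_five_sq : (Real.sqrt 5 : ℂ) ^ 2 = 5 := by
  rw [← Complex.ofReal_pow, Real.sq_sqrt (by norm_num)]; norm_num

lemma sub_α_mul_sub_β (w : ℂ) : (w - α) * (w - β) = w ^ 2 - 11 * w - 1 := by
  rw [α, β]
  linear_combination (-25 / 4) * sqrt_five_sq

lemma f_ne_zero {τ : ℂ} (hτ : 0 < τ.im) : f τ ≠ 0 := by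
  rw [f_eq_exp hτ]
  exact mul_ne_zero α_ne_zero (Complex.exp_ne_zero _)

lemma tendsto_sinSeries_cusp (u : ℝ) :
    Filter.Tendsto (fun t : ℝ => sinSeries 0 0 (nome (t * Complex.I)) u) Filter.atTop (𝓝 0) :=
  (tendsto_lambert_zero ((polyBounded_sin 0 0).apply u)).comp
    (tendsto_nome_atImInfty.mono_right nhdsWithin_le_nhds)

lemma im_pos_of_pos {t : ℝ} (ht : 0 < t) : 0 < ((t : ℂ) * Complex.I).im := by simpa using ht

lemma tendsto_Q_cusp : Filter.Tendsto (fun t : ℝ => Q (t * Complex.I)) Filter.atTop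
    (𝓝 (Real.cot (Real.pi / 5))) := by
  have h := ((tendsto_sinSeries_cusp (2 * Real.pi / 5)).const_mul 4).const_add
    (Real.cot (Real.pi / 5) : ℂ)
  rw [mul_zero, add_zero] at h
  refine h.congr' ?_
  filter_upwards [Filter.eventually_gt_atTop 0] with t ht
  rw [Q_eq_cotSeries (im_pos_of_pos ht), cotSeries, show 2 * Real.pi / 5 / 2 = Real.pi / 5 by ring]

lemma tendsto_P_cusp : Filter.Tendsto (fun t : ℝ => P (t * Complex.I)) Filter.atTop
    (𝓝 (Real.cot (2 * Real.pi / 5))) := by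
  have h := ((tendsto_sinSeries_cusp (4 * Real.pi / 5)).const_mul 4).const_add
    (Real.cot (2 * Real.pi / 5) : ℂ)
  rw [mul_zero, add_zero] at h
  refine h.congr' ?_
  filter_upwards [Filter.eventually_gt_atTop 0] with t ht
  rw [P_eq_cotSeries (im_pos_of_pos ht), cotSeries,
    show 4 * Real.pi / 5 / 2 = 2 * Real.pi / 5 by ring]

lemma tendsto_f_cusp : Filter.Tendsto (fun t : ℝ => f (t * Complex.I)) Filter.atTop (𝓝 α) := by
  have h := ((((tendsto_lambert_zero polyBounded_logCoeff).comp
    (tendsto_nome_atImInfty.mono_right nhdsWithin_le_nhds)).const_mul 5).cexp).const_mul α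
  rw [mul_zero, Complex.exp_zero, mul_one] at h
  refine h.congr' ?_
  filter_upwards [Filter.eventually_gt_atTop 0] with t ht
  exact (f_eq_exp (im_pos_of_pos ht)).symm

lemma cot_pi_div_five_pos : 0 < Real.cot (Real.pi / 5) := by
  have hpi := Real.pi_pos
  rw [Real.cot_eq_cos_div_sin]
  exact div_pos (Real.cos_pos_of_mem_Ioo ⟨by linarith, by linarith⟩)
    (Real.sin_pos_of_pos_of_lt_pi (by linarith) (by linarith))

lemma cot_two_pi_div_five : Real.cot (2 * Real.pi / 5) = (√5 - 2) * Real.cot (Real.pi / 5) := by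
  have hpi := Real.pi_pos
  have hs : Real.sin (Real.pi / 5) ≠ 0 :=
    (Real.sin_pos_of_pos_of_lt_pi (by linarith) (by linarith)).ne'
  have hc : 1 + √5 ≠ 0 := by positivity
  have h5 : √5 ^ 2 = 5 := Real.sq_sqrt (by norm_num)
  rw [Real.cot_eq_cos_div_sin, Real.cot_eq_cos_div_sin, cos_two_pi_div_five,
    show 2 * Real.pi / 5 = 2 * (Real.pi / 5) by ring, Real.sin_two_mul, Real.cos_pi_div_five]
  field_simp
  linear_combination (-2 * √5) * h5

/-! ### Non-vanishing -/

lemma isOpen_im_pos : IsOpen {z : ℂ | 0 < z.im} :=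
  isOpen_lt continuous_const Complex.continuous_im

lemma isPreconnected_im_pos : IsPreconnected {z : ℂ | 0 < z.im} :=
  (convex_halfSpace_im_gt 0).isPreconnected

/-- A solution of a linear homogeneous equation of first order which has a zero is zero. -/
lemma eq_zero_of_hasDerivAt_mul {g k : ℂ → ℂ} (hk : DifferentiableOn ℂ k {z | 0 < z.im})
    (hg : ∀ z : ℂ, 0 < z.im → HasDerivAt g (k z * g z) z) {z₀ : ℂ} (hz₀ : 0 < z₀.im)
    (h0 : g z₀ = 0) : ∀ z : ℂ, 0 < z.im → g z = 0 := by
  have hd : DifferentiableOn ℂ g {z | 0 < z.im} := fun z hz =>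
    (hg z hz).differentiableAt.differentiableWithinAt
  have ha := hd.analyticOnNhd isOpen_im_pos
  have hka := hk.analyticOnNhd isOpen_im_pos
  have hev : deriv g =ᶠ[𝓝 z₀] k * g := by
    filter_upwards [isOpen_im_pos.mem_nhds hz₀] with z hz
    exact (hg z hz).deriv
  -- Orders of vanishing at z₀: that of g' is one less than that of g, yet g' = kg vanishes at least
  -- as much as g. Only infinite order is possible.
  have h1 := (ha z₀ hz₀).analyticOrderAt_deriv_add_one
  simp only [h0, sub_zero] at h1
  rw [analyticOrderAt_congr hev, analyticOrderAt_mul (hka z₀ hz₀) (ha z₀ hz₀)] at h1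
  have htop : analyticOrderAt g z₀ = ⊤ := by
    by_contra h
    obtain ⟨n, hn⟩ := ENat.ne_top_iff_exists.1 h
    rw [← hn] at h1
    have h2 : ((n + 1 : ℕ) : ℕ∞) ≤ n := by
      rw [← h1, add_assoc]
      push_cast
      exact le_add_self
    exact absurd (Nat.cast_le.1 h2) (by omega)
  have h2 := ha.eqOn_zero_of_preconnected_of_eventuallyEq_zero isPreconnected_im_pos hz₀
    (analyticOrderAt_eq_top.1 htop)
  exact fun z hz => h2 hz

lemma differentiableOn_of_hasDerivAt {g g' : ℂ → ℂ}
    (h : ∀ z : ℂ, 0 < z.im → HasDerivAt g (g' z) z) : DifferentiableOn ℂ g {z | 0 < z.im} :=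
  fun z hz => (h z hz).differentiableAt.differentiableWithinAt

lemma S_cusp_ne_zero :
    -3 * (Real.cot (2 * Real.pi / 5) : ℂ) + (Real.cot (Real.pi / 5) : ℂ) ≠ 0 := by
  -- The cusp value is (7 - 3√5) cot(π/5), so this bound makes it positive.
  have h : √5 < 7 / 3 := by
    rw [Real.sqrt_lt' (by norm_num)]; norm_num
  have hc := cot_pi_div_five_pos
  have hr : -3 * Real.cot (2 * Real.pi / 5) + Real.cot (Real.pi / 5) ≠ 0 := by
    rw [cot_two_pi_div_five]
    nlinarith
  rw [← Complex.ofReal_ne_zero] at hr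
  simpa only [Complex.ofReal_add, Complex.ofReal_mul, Complex.ofReal_neg,
    Complex.ofReal_ofNat] using hr

lemma tendsto_S_cusp : Filter.Tendsto (fun t : ℝ => S (t * Complex.I)) Filter.atTop
    (𝓝 (-3 * (Real.cot (2 * Real.pi / 5) : ℂ) + (Real.cot (Real.pi / 5) : ℂ))) :=
  (tendsto_P_cusp.const_mul (-3)).add tendsto_Q_cusp

lemma S_ne_zero {τ : ℂ} (hτ : 0 < τ.im) : S τ ≠ 0 := by
  intro h0
  have h := eq_zero_of_hasDerivAt_mul (k := fun z => 2 * Real.pi * Complex.I * logDerivS z)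
    ((differentiableOn_of_hasDerivAt fun z hz => hasDerivAt_logDerivS hz).const_mul _)
    (fun z hz => hasDerivAt_S hz) hτ h0
  refine S_cusp_ne_zero (tendsto_nhds_unique tendsto_S_cusp ?_)
  refine tendsto_const_nhds.congr' ?_
  filter_upwards [Filter.eventually_gt_atTop 0] with t ht
  exact (h _ (im_pos_of_pos ht)).symm

/-- Both sides have the same logarithmic derivative, so their quotient is constant. At the cusp it
is 1, because α(7 - 3√5) = 1 + √5. -/
lemma f_mul_S {τ : ℂ} (hτ : 0 < τ.im) : f τ * S τ = V τ := by
  have hd : ∀ z : ℂ, 0 < z.im → HasDerivAt (fun z => V z / (f z * S z)) 0 z := by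
    intro z hz
    have hf := f_ne_zero hz
    have hS := S_ne_zero hz
    refine ((hasDerivAt_V hz).div ((hasDerivAt_f hz).fun_mul (hasDerivAt_S hz))
      (mul_ne_zero hf hS)).congr_deriv ?_
    rw [div_eq_zero_iff]
    left
    simp only [logDerivS, V, S]
    ring
  have hconst : ∀ z : ℂ, 0 < z.im → V z / (f z * S z) = V τ / (f τ * S τ) := by
    intro z hz
    exact isOpen_im_pos.is_const_of_deriv_eq_zero isPreconnected_im_pos
      (differentiableOn_of_hasDerivAt hd) (fun z hz => (hd z hz).deriv) hz hτ
  have hlim := (tendsto_P_cusp.add (tendsto_Q_cusp.const_mul 3)).div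
    (tendsto_f_cusp.mul tendsto_S_cusp) (mul_ne_zero α_ne_zero S_cusp_ne_zero)
  have h1 := tendsto_nhds_unique hlim (tendsto_const_nhds.congr' (by
    filter_upwards [Filter.eventually_gt_atTop 0] with t ht
    exact (hconst _ (im_pos_of_pos ht)).symm))
  have h2 : V τ / (f τ * S τ) = 1 := by
    rw [← h1, div_eq_one_iff_eq (mul_ne_zero α_ne_zero S_cusp_ne_zero), cot_two_pi_div_five, α]
    simp only [Complex.ofReal_mul, Complex.ofReal_sub, Complex.ofReal_ofNat]
    linear_combination (15 / 2 * (Real.cot (Real.pi / 5) : ℂ)) * sqrt_five_sq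
  rw [div_eq_one_iff_eq (mul_ne_zero (f_ne_zero hτ) (S_ne_zero hτ))] at h2
  exact h2.symm

/-- Substituting fS = V gives V² - 11VS - S², a multiple of the quadratic form that occurs in f'/f.
-/
lemma S_sq_mul {τ : ℂ} (hτ : 0 < τ.im) :
    S τ ^ 2 * ((f τ - α) * (f τ - β)) = 25 * (P τ ^ 2 + 4 * P τ * Q τ - Q τ ^ 2) := by
  have h := f_mul_S hτ
  rw [sub_α_mul_sub_β]
  have e : S τ ^ 2 * (f τ ^ 2 - 11 * f τ - 1)
      = (f τ * S τ) ^ 2 - 11 * (f τ * S τ) * S τ - S τ ^ 2 := by ring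
  rw [e, h, V, S]
  ring

lemma hasDerivAt_f' {τ : ℂ} (hτ : 0 < τ.im) :
    HasDerivAt f (2 * Real.pi * Complex.I / 20 * (f τ * (f τ - α) * (f τ - β) * S τ ^ 2)) τ := by
  refine (hasDerivAt_f hτ).congr_deriv ?_
  linear_combination (-(2 * Real.pi * Complex.I / 20) * f τ) * S_sq_mul hτ

lemma differentiableOn_f : DifferentiableOn ℂ f {z | 0 < z.im} :=
  differentiableOn_of_hasDerivAt fun _ hz => hasDerivAt_f hz

lemma differentiableOn_S : DifferentiableOn ℂ S {z | 0 < z.im} :=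
  differentiableOn_of_hasDerivAt fun _ hz => hasDerivAt_S hz

/-- `f` is not constant: its first Fourier coefficient does not vanish. -/
lemma not_forall_f_eq (c : ℂ) : ¬ ∀ z : ℂ, 0 < z.im → f z = c := by
  intro h
  have hz : ∀ z : ℂ, 0 < z.im → lambert (fun d e => d * e * logCoeff d e) (nome z) = 0 := by
    intro z hz
    have h1 := ((((hasDerivAt_lambert_nome polyBounded_logCoeff hz).const_mul 5).cexp).const_mul α)
    have h2 : HasDerivAt (fun _ : ℂ => c) 0 z := hasDerivAt_const z c
    have h3 := h1.unique (h2.congr_of_eventuallyEq (by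
      filter_upwards [isOpen_im_pos.mem_nhds hz] with y hy
      rw [← f_eq_exp hy, h y hy]))
    simpa [Real.pi_ne_zero, Complex.exp_ne_zero, α_ne_zero] using h3
  have hb : PolyBounded fun (_ : Unit) (d e : ℕ+) => (d : ℂ) * e * logCoeff d e := by
    obtain ⟨C, k, h⟩ := polyBounded_logCoeff
    refine ⟨C, k + 1, fun i d e => ?_⟩
    rw [norm_mul, norm_mul, Complex.norm_natCast, Complex.norm_natCast, pow_succ]
    have := h i d e
    calc (d : ℝ) * e * ‖logCoeff d e‖ ≤ (d : ℝ) * e * (C * ((d : ℝ) * e) ^ k) := by gcongr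
      _ = _ := by ring
  have hl := (tendsto_lambert_div hb).comp tendsto_nome_atImInfty
  have h0 := tendsto_nhds_unique hl (tendsto_const_nhds.congr' (by
    filter_upwards [Filter.eventually_gt_atTop 0] with t ht
    simp only [Function.comp]
    rw [hz _ (im_pos_of_pos ht), zero_div]))
  simp only [logCoeff, PNat.one_coe, Nat.cast_one, one_mul, div_one] at h0
  rw [cos_two_pi_div_five, cos_four_pi_div_five, ← Complex.ofReal_sub, Complex.ofReal_eq_zero] at h0
  have : (0 : ℝ) < √5 := by positivity
  linarith

/-- By `hasDerivAt_f'` the derivative of f - α is divisible by f - α, so a single zero would make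
`f` constant. -/
lemma f_ne_α {τ : ℂ} (hτ : 0 < τ.im) : f τ ≠ α := by
  intro h0
  refine not_forall_f_eq α fun z hz => sub_eq_zero.1 ?_
  refine eq_zero_of_hasDerivAt_mul (g := fun z => f z - α)
    (k := fun z => 2 * Real.pi * Complex.I / 20 * (f z * (f z - β) * S z ^ 2))
    (((differentiableOn_f.mul (differentiableOn_f.sub_const β)).mul
      (differentiableOn_S.pow 2)).const_mul _) (fun z hz => ?_) hτ (sub_eq_zero.2 h0) z hz
  exact ((hasDerivAt_f' hz).sub_const α).congr_deriv (by ring)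

lemma f_ne_β {τ : ℂ} (hτ : 0 < τ.im) : f τ ≠ β := by
  intro h0
  refine not_forall_f_eq β fun z hz => sub_eq_zero.1 ?_
  refine eq_zero_of_hasDerivAt_mul (g := fun z => f z - β)
    (k := fun z => 2 * Real.pi * Complex.I / 20 * (f z * (f z - α) * S z ^ 2))
    (((differentiableOn_f.mul (differentiableOn_f.sub_const α)).mul
      (differentiableOn_S.pow 2)).const_mul _) (fun z hz => ?_) hτ (sub_eq_zero.2 h0) z hz
  exact ((hasDerivAt_f' hz).sub_const β).congr_deriv (by ring)

lemma deriv_f_ne_zero {τ : ℂ} (hτ : 0 < τ.im) :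
    2 * Real.pi * Complex.I / 20 * (f τ * (f τ - α) * (f τ - β) * S τ ^ 2) ≠ 0 := by
  have h1 := f_ne_zero hτ
  have h2 := sub_ne_zero.2 (f_ne_α hτ)
  have h3 := sub_ne_zero.2 (f_ne_β hτ)
  have h4 := S_ne_zero hτ
  have h5 : (Real.pi : ℂ) ≠ 0 := Complex.ofReal_ne_zero.2 Real.pi_ne_zero
  have h6 := Complex.I_ne_zero
  exact mul_ne_zero (div_ne_zero (mul_ne_zero (mul_ne_zero two_ne_zero h5) h6) (by norm_num))
    (mul_ne_zero (mul_ne_zero (mul_ne_zero h1 h2) h3) (pow_ne_zero 2 h4))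

/-! ### The inverse of `f` and the Heun equation -/

lemma exists_isInverseBranch {τ : ℂ} (hτ : 0 < τ.im) :
    ∃ (U : Set ℂ) (σ : ℂ → ℂ), IsInverseBranch σ U ∧ f τ ∈ U ∧ ∀ᶠ z in 𝓝 τ, σ (f z) = z := by
  have ha : AnalyticAt ℂ f τ := differentiableOn_f.analyticAt (isOpen_im_pos.mem_nhds hτ)
  have hd : deriv f τ ≠ 0 := by rw [(hasDerivAt_f' hτ).deriv]; exact deriv_f_ne_zero hτ
  have hs : HasStrictFDerivAt f (ContinuousLinearEquiv.unitsEquivAut ℂ (Units.mk0 _ hd) : ℂ →L[ℂ] ℂ) τ :=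
    ha.hasStrictDerivAt.hasStrictFDerivAt_equiv hd
  -- Restricting the source to the upper half plane forces the inverse branch to take its values
  -- there.
  let R := (hs.toOpenPartialHomeomorph f).restrOpen {z | 0 < z.im} isOpen_im_pos
  have hRf : ∀ z, R z = f z := fun z => rfl
  have hsource : ∀ z ∈ R.source, 0 < z.im := fun z hz => hz.2
  have hτR : τ ∈ R.source := ⟨hs.mem_toOpenPartialHomeomorph_source, hτ⟩
  refine ⟨R.target, R.symm, ⟨R.open_target, fun w hw => ?_, fun w hw => hsource _ (R.map_target hw),
    fun w hw => R.right_inv hw⟩, R.map_source hτR, ?_⟩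
  · have hz := hsource _ (R.map_target hw)
    exact (R.hasDerivAt_symm hw (deriv_f_ne_zero hz)
      (hasDerivAt_f' hz)).differentiableAt.differentiableWithinAt
  · filter_upwards [R.open_source.mem_nhds hτR] with z hz
    exact R.left_inv hz

section InverseBranch

variable {U : Set ℂ} {σ : ℂ → ℂ}

lemma IsInverseBranch.ne (h : IsInverseBranch σ U) {w : ℂ} (hw : w ∈ U) :
    w ≠ 0 ∧ w ≠ α ∧ w ≠ β := by
  have hz := h.im_pos w hw
  have hf := h.right_inv w hw
  exact ⟨hf ▸ f_ne_zero hz, hf ▸ f_ne_α hz, hf ▸ f_ne_β hz⟩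

lemma IsInverseBranch.hasDerivAt (h : IsInverseBranch σ U) {w : ℂ} (hw : w ∈ U) :
    HasDerivAt σ (2 * Real.pi * Complex.I / 20 * (w * (w - α) * (w - β) * S (σ w) ^ 2))⁻¹ w := by
  have hd := (h.differentiableOn.differentiableAt (h.isOpen.mem_nhds hw)).hasDerivAt
  have hz := h.im_pos w hw
  have hf := hasDerivAt_f' hz
  have h0 := deriv_f_ne_zero hz
  rw [h.right_inv w hw] at hf h0
  have hid : HasDerivAt (fun w => f (σ w)) 1 w :=
    (hasDerivAt_id w).congr_of_eventuallyEq (by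
      filter_upwards [h.isOpen.mem_nhds hw] with x hx using h.right_inv x hx)
  have := (hf.comp w hd).unique hid
  exact hd.congr_deriv (eq_inv_of_mul_eq_one_right this)

lemma IsInverseBranch.hasDerivAt_S (h : IsInverseBranch σ U) {w : ℂ} (hw : w ∈ U) :
    HasDerivAt (fun u => S (σ u))
      (20 * logDerivS (σ w) / (w * (w - α) * (w - β) * S (σ w))) w := by
  have hz := h.im_pos w hw
  obtain ⟨h1, h2, h3⟩ := h.ne hw
  have h2 := sub_ne_zero.2 h2
  have h3 := sub_ne_zero.2 h3
  have h4 := S_ne_zero hz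
  have h5 := Complex.two_pi_I_ne_zero
  refine ((LevelFive.hasDerivAt_S hz).comp w (h.hasDerivAt hw)).congr_deriv ?_
  generalize (2 * Real.pi * Complex.I : ℂ) = c at h5 ⊢
  field_simp

/-- Differentiate 20L/(pS), with p = w(w - α)(w - β). The factor 1/p contributes the coefficient of
dy/dw through p'/p, the terms in L² cancel, and the inhomogeneous part of the Riccati equation
supplies the multiple of `S`. -/
lemma IsInverseBranch.hasDerivAt_deriv_S (h : IsInverseBranch σ U) {w : ℂ} (hw : w ∈ U) :
    HasDerivAt (deriv fun u => S (σ u))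
      (-((1 / w + 1 / (w - α) + 1 / (w - β)) * (20 * logDerivS (σ w)
          / (w * (w - α) * (w - β) * S (σ w)))
        + (w - 3) / (w * (w - α) * (w - β)) * S (σ w))) w := by
  have hz := h.im_pos w hw
  obtain ⟨h1, h2, h3⟩ := h.ne hw
  have h2 := sub_ne_zero.2 h2
  have h3 := sub_ne_zero.2 h3
  have h4 := S_ne_zero hz
  have h5 := Complex.two_pi_I_ne_zero
  have hσ := h.hasDerivAt hw
  have hV := f_mul_S hz
  have hS2 := S_sq_mul hz
  rw [h.right_inv w hw] at hV hS2
  -- From V - 3S = 10P and V = wS; this produces the numerator w - 3 of the Heun equation.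
  have hP : 10 * P (σ w) = (w - 3) * S (σ w) := by
    rw [sub_mul, hV, V, S]; ring
  have hL : HasDerivAt (fun u => 20 * logDerivS (σ u)) _ w :=
    ((hasDerivAt_logDerivS hz).comp w hσ).const_mul 20
  have hp : HasDerivAt (fun u => u * (u - α) * (u - β)) _ w :=
    ((hasDerivAt_id w).fun_mul ((hasDerivAt_id w).sub_const α)).fun_mul
      ((hasDerivAt_id w).sub_const β)
  have hq := hL.fun_div (hp.fun_mul (h.hasDerivAt_S hw))
    (mul_ne_zero (mul_ne_zero (mul_ne_zero h1 h2) h3) h4)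
  refine (hq.congr_of_eventuallyEq ?_).congr_deriv ?_
  · filter_upwards [h.isOpen.mem_nhds hw] with x hx using (h.hasDerivAt_S hx).deriv
  -- With V = wS, 10P = (w - 3)S and `S_sq_mul`, the inhomogeneous term becomes a function of w
  -- times S⁴; the power of `S` drops to one after division by the denominators.
  · have key : 5 / 8 * P (σ w) * V (σ w) * (P (σ w) ^ 2 + 4 * P (σ w) * Q (σ w) - Q (σ w) ^ 2)
        = (w - 3) * (w * (w - α) * (w - β)) * S (σ w) ^ 4 / 400 := by
      rw [← hV]
      linear_combination (1 / 40 * P (σ w) * w * S (σ w)) * (-hS2)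
        + (1 / 400 * w * S (σ w) ^ 3 * ((w - α) * (w - β))) * hP
    rw [key]
    simp only [id]
    generalize (2 * Real.pi * Complex.I : ℂ) = c at h5 ⊢
    generalize w - α = a at h2 ⊢
    generalize w - β = b at h3 ⊢
    field_simp
    ring

end InverseBranch

end LevelFive

end

theorem mainTheorem1 :
    (∀ τ : ℂ, 0 < τ.im →
      ∃ (U : Set ℂ) (σ : ℂ → ℂ), LevelFive.IsInverseBranch σ U ∧ LevelFive.f τ ∈ U ∧
        ∀ᶠ z in 𝓝 τ, σ (LevelFive.f z) = z) ∧
    (∀ (U : Set ℂ) (σ : ℂ → ℂ), LevelFive.IsInverseBranch σ U →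
      DifferentiableOn ℂ (fun w => LevelFive.S (σ w)) U ∧
      ∀ w ∈ U, w ≠ 0 ∧ w ≠ LevelFive.α ∧ w ≠ LevelFive.β ∧
        deriv (deriv (fun u => LevelFive.S (σ u))) w
          + (1 / w + 1 / (w - LevelFive.α) + 1 / (w - LevelFive.β))
              * deriv (fun u => LevelFive.S (σ u)) w
          + (w - 3) / (w * (w - LevelFive.α) * (w - LevelFive.β)) * LevelFive.S (σ w) = 0) := by
  refine ⟨fun τ hτ => LevelFive.exists_isInverseBranch hτ, fun U σ h =>
    ⟨fun w hw => (h.hasDerivAt_S hw).differentiableAt.differentiableWithinAt, fun w hw => ?_⟩⟩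
  obtain ⟨h1, h2, h3⟩ := h.ne hw
  refine ⟨h1, h2, h3, ?_⟩
  rw [(h.hasDerivAt_deriv_S hw).deriv, (h.hasDerivAt_S hw).deriv]
  ring
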